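/- Rings are associative with identity; ring homomorphisms are not required to preserve the identity, so a ring epimorphism is a ring homomorphism $f$ such that $g\circ f=h\circ f$ implies $g=h$ for all rings $T$ and all such homomorphisms $g,h:S\to T$. (For identity-preserving $f$ this is the usual notion of an epimorphism of rings with identity, tested on identity-preserving $g,h$.) Given a Gabriel filter $\mathcal F_l$ of left ideals and a Gabriel filter $\mathcal F_r$ of right ideals of a ring $R$, let $\mathcal T$ be the two-sided ideal of all $r\in R$ such that $Ir=0$ for some $I\in\mathcal F_l$ and $rJ=0$ for some $J\in\mathcal F_r$, and let $\overline R=R/\mathcal T$. A compatible pair $(\alpha,\beta)$ consists of a homomorphism of left $R$-modules $\alpha:I\to\overline R$ with $I\in\mathcal F_l$ and a homomorphism of right $R$-modules $\beta:J\to\overline R$ with $J\in\mathcal F_r$ such that $\alpha(i)j=i\beta(j)$ for all $i\in I$, $j\in J$. Two compatible pairs are equivalent if their first components agree on some member of $\mathcal F_l$ and their second components agree on some member of $\mathcal F_r$. The symmetric ring of quotients ${}_{\mathcal F_l}R_{\mathcal F_r}$ is the set of equivalence classes of compatible pairs, with component-wise addition on the intersections of the domains. The product $(\alpha,\beta)(\gamma,\delta)$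 is the class of the pair $(\gamma\circ\alpha,\ \beta\circ\delta)$: the outer maps factor through the images of their domains in $\overline R$, and the composites are defined on $\{i:\alpha(i)\in\overline{\operatorname{dom}\gamma}\}\in\mathcal F_l$ and $\{j:\delta(j)\in\overline{\operatorname{dom}\beta}\}\in\mathcal F_r$. The canonical map $q_R:R\to{}_{\mathcal F_l}R_{\mathcal F_r}$ sends $a$ to the class of $(i\mapsto \overline{ia},\ j\mapsto\overline{aj})$ with domains $I=J=R$. **Theorem.** For a ring homomorphism $f:R\to S$ the following conditions are equivalent. 1. $f$ is a ring epimorphism and makes $S$ into a flat left $R$-module and a flat right $R$-module. 2. The family of left ideals $\mathcal F_l=\{I\mid Sf(I)=S\}$ is a Gabriel filter of left ideals of $R$, the family of right ideals $\mathcal F_r=\{J\mid f(J)S=S\}$ is a Gabriel filter of right ideals of $R$, and there is a ring isomorphism $g:S\cong{}_{\mathcal F_l}R_{\mathcal F_r}$ such that $g\circ f=q_R$. 3. The following two conditions hold. - (i) For every $s\in S$ there are finitely many $r_1,\dots,r_n\in R$, $s_1,\dots,s_n\in S$ with $f(r_i)s\in f(R)$ for all $i$ and $\sum_{i=1}^n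 s_if(r_i)=1$, and finitely many $r'_1,\dots,r'_m\in R$, $s'_1,\dots,s'_m\in S$ with $sf(r'_j)\in f(R)$ for all $j$ and $\sum_{j=1}^m f(r'_j)s'_j=1$. - (ii) For every $r\in R$ with $f(r)=0$ there are finitely many $r_1,\dots,r_n\in R$, $s_1,\dots,s_n\in S$ with $r_ir=0$ for all $i$ and $\sum_{i=1}^n s_if(r_i)=1$, and finitely many $r'_1,\dots,r'_m\in R$, $s'_1,\dots,s'_m\in S$ with $rr'_j=0$ for all $j$ and $\sum_{j=1}^m f(r'_j)s'_j=1$. -/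

import Mathlib

universe u v

open scoped TensorProduct

namespace SymQuot

/-! ### Ring epimorphisms -/

/-- Rings are associative with identity; homomorphisms of rings are not assumed to preserve the
identity. `f` is a ring epimorphism if `g ∘ f = h ∘ f` implies `g = h` for all rings `T` and ring
homomorphisms `g h : S → T`. (Restricting `T` to the universe of `S` loses nothing: `T` can be
replaced by the subring generated by the images of `g` and `h`. For `f` preserving the identity,
see `isRingEpi_coe_iff`.) -/
def IsRingEpi {R : Type u} {S : Type v} [Ring R] [Ring S] (f : R →ₙ+* S) : Prop :=
  ∀ (T : Type v) [Ring T] (g h : S →ₙ+* T), g.comp f = h.comp f → g = h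

/-- For a homomorphism that preserves the identity, `IsRingEpi` is the usual notion of an
epimorphism in the category of rings with identity and identity-preserving homomorphisms. -/
theorem isRingEpi_coe_iff {R : Type u} {S : Type v} [Ring R] [Ring S] (f : R →+* S) :
    IsRingEpi (f : R →ₙ+* S) ↔
      ∀ (T : Type v) [Ring T] (g h : S →+* T), g.comp f = h.comp f → g = h := by
  constructor
  · intro H T _ g h hgh
    have := H T (g : S →ₙ+* T) (h : S →ₙ+* T) (by
      ext r
      exact RingHom.congr_fun hgh r)
    ext s
    exact DFunLike.congr_fun this s
  · intro H T _ g h hgh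
    have hfr : ∀ r, g (f r) = h (f r) := fun r => DFunLike.congr_fun hgh r
    have h1 : h 1 = g 1 := by simpa using (hfr 1).symm
    have he : IsIdempotentElem (g 1) := by
      rw [IsIdempotentElem, ← map_mul, one_mul]
    have hg : ∀ s, g s ∈ Subsemigroup.corner (g 1) := fun s => by
      rw [Subsemigroup.mem_corner_iff he]
      exact ⟨by rw [← map_mul, one_mul], by rw [← map_mul, mul_one]⟩
    have hh : ∀ s, h s ∈ Subsemigroup.corner (g 1) := fun s => by
      rw [Subsemigroup.mem_corner_iff he, ← h1]
      exact ⟨by rw [← map_mul, one_mul], by rw [← map_mul, mul_one]⟩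
    let g' : S →+* he.Corner :=
      { toFun := fun s => ⟨g s, hg s⟩
        map_one' := rfl
        map_mul' := fun a b => Subtype.ext (map_mul g a b)
        map_zero' := Subtype.ext (map_zero g)
        map_add' := fun a b => Subtype.ext (map_add g a b) }
    let h' : S →+* he.Corner :=
      { toFun := fun s => ⟨h s, hh s⟩
        map_one' := Subtype.ext h1
        map_mul' := fun a b => Subtype.ext (map_mul h a b)
        map_zero' := Subtype.ext (map_zero h)
        map_add' := fun a b => Subtype.ext (map_add h a b) }
    have hgh' : g' = h' := H _ g' h' (by
      ext r
      exact Subtype.ext (hfr r))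
    ext s
    exact congrArg Subtype.val (DFunLike.congr_fun hgh' s)

/-! ### Flatness over a noncommutative ring -/

section Flat

variable {R : Type u} {S : Type v} [Ring R] [Ring S] (f : R →ₙ+* S)

/-- For a right `R`-module `M`, the subgroup of `M ⊗[ℤ] S` by which one has to divide in order to
obtain `M ⊗_R S`, where `S` is a left `R`-module through `f`. -/
def balancedRight (M : Type u) [AddCommGroup M] [Module Rᵐᵒᵖ M] : AddSubgroup (M ⊗[ℤ] S) :=
  AddSubgroup.closure
    {x | ∃ (m : M) (r : R) (s : S), x = (MulOpposite.op r • m) ⊗ₜ[ℤ] s - m ⊗ₜ[ℤ] (f r * s)}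

/-- For a left `R`-module `M`, the subgroup of `S ⊗[ℤ] M` by which one has to divide in order to
obtain `S ⊗_R M`, where `S` is a right `R`-module through `f`. -/
def balancedLeft (M : Type u) [AddCommGroup M] [Module R M] : AddSubgroup (S ⊗[ℤ] M) :=
  AddSubgroup.closure
    {x | ∃ (m : M) (r : R) (s : S), x = (s * f r) ⊗ₜ[ℤ] m - s ⊗ₜ[ℤ] (r • m)}

/-- The abelian group `M ⊗_R S`. -/
abbrev TensorRight (M : Type u) [AddCommGroup M] [Module Rᵐᵒᵖ M] : Type (max u v) :=
  (M ⊗[ℤ] S) ⧸ balancedRight f M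

/-- The abelian group `S ⊗_R M`. -/
abbrev TensorLeft (M : Type u) [AddCommGroup M] [Module R M] : Type (max u v) :=
  (S ⊗[ℤ] M) ⧸ balancedLeft f M

/-- `φ ⊗_R S : M ⊗_R S → N ⊗_R S`. -/
def tensorRightMap {M N : Type u} [AddCommGroup M] [Module Rᵐᵒᵖ M] [AddCommGroup N]
    [Module Rᵐᵒᵖ N] (φ : M →ₗ[Rᵐᵒᵖ] N) : TensorRight f M →+ TensorRight f N :=
  QuotientAddGroup.map _ _ (φ.toAddMonoidHom.toIntLinearMap.rTensor S).toAddMonoidHom (by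
    rw [balancedRight, AddSubgroup.closure_le]
    rintro _ ⟨m, r, s, rfl⟩
    refine AddSubgroup.subset_closure ⟨φ m, r, s, ?_⟩
    simp)

/-- `S ⊗_R φ : S ⊗_R M → S ⊗_R N`. -/
def tensorLeftMap {M N : Type u} [AddCommGroup M] [Module R M] [AddCommGroup N]
    [Module R N] (φ : M →ₗ[R] N) : TensorLeft f M →+ TensorLeft f N :=
  QuotientAddGroup.map _ _ (φ.toAddMonoidHom.toIntLinearMap.lTensor S).toAddMonoidHom (by
    rw [balancedLeft, AddSubgroup.closure_le]
    rintro _ ⟨m, r, s, rfl⟩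
    refine AddSubgroup.subset_closure ⟨φ m, r, s, ?_⟩
    simp)

/-- `f` makes `S` into a flat left `R`-module: `- ⊗_R S` preserves injectivity of homomorphisms of
right `R`-modules. -/
def IsLeftFlat : Prop :=
  ∀ (M N : Type u) [AddCommGroup M] [Module Rᵐᵒᵖ M] [AddCommGroup N] [Module Rᵐᵒᵖ N]
    (φ : M →ₗ[Rᵐᵒᵖ] N), Function.Injective φ → Function.Injective (tensorRightMap f φ)

/-- `f` makes `S` into a flat right `R`-module: `S ⊗_R -` preserves injectivity of homomorphisms of
left `R`-modules. -/
def IsRightFlat : Prop :=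
  ∀ (M N : Type u) [AddCommGroup M] [Module R M] [AddCommGroup N] [Module R N]
    (φ : M →ₗ[R] N), Function.Injective φ → Function.Injective (tensorLeftMap f φ)

end Flat

/-! ### Gabriel filters -/

section Gabriel

variable {R : Type u} [Ring R]

/-- `(I : a) = {r | r * a ∈ I}` for a left ideal `I`. -/
def leftColon (I : Submodule R R) (a : R) : Submodule R R where
  carrier := {r | r * a ∈ I}
  add_mem' := fun {x y} hx hy => by
    simpa [add_mul] using I.add_mem hx hy
  zero_mem' := by simp
  smul_mem' := fun c x hx => by
    simpa [mul_assoc] using I.smul_mem c hx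

/-- `(a : J) = {r | a * r ∈ J}` for a right ideal `J`. -/
def rightColon (J : Submodule Rᵐᵒᵖ R) (a : R) : Submodule Rᵐᵒᵖ R where
  carrier := {r | a * r ∈ J}
  add_mem' := fun {x y} hx hy => by
    simpa [mul_add] using J.add_mem hx hy
  zero_mem' := by simp
  smul_mem' := fun c x hx => by
    simpa [mul_assoc] using J.smul_mem c hx

@[simp] theorem mem_leftColon {I : Submodule R R} {a r : R} :
    r ∈ leftColon I a ↔ r * a ∈ I := Iff.rfl

@[simp] theorem mem_rightColon {J : Submodule Rᵐᵒᵖ R} {a r : R} :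
    r ∈ rightColon J a ↔ a * r ∈ J := Iff.rfl

variable (R)

/-- A Gabriel filter of left ideals of `R`. -/
structure LeftGabrielFilter where
  sets : Set (Submodule R R)
  top_mem : ⊤ ∈ sets
  mem_of_le : ∀ {I I' : Submodule R R}, I ∈ sets → I ≤ I' → I' ∈ sets
  inf_mem : ∀ {I I' : Submodule R R}, I ∈ sets → I' ∈ sets → I ⊓ I' ∈ sets
  colon_mem : ∀ {I : Submodule R R}, I ∈ sets → ∀ a : R, leftColon I a ∈ sets
  mem_of_colon : ∀ {I I' : Submodule R R}, I' ∈ sets →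
    (∀ a ∈ I', leftColon I a ∈ sets) → I ∈ sets

/-- A Gabriel filter of right ideals of `R`. -/
structure RightGabrielFilter where
  sets : Set (Submodule Rᵐᵒᵖ R)
  top_mem : ⊤ ∈ sets
  mem_of_le : ∀ {J J' : Submodule Rᵐᵒᵖ R}, J ∈ sets → J ≤ J' → J' ∈ sets
  inf_mem : ∀ {J J' : Submodule Rᵐᵒᵖ R}, J ∈ sets → J' ∈ sets → J ⊓ J' ∈ sets
  colon_mem : ∀ {J : Submodule Rᵐᵒᵖ R}, J ∈ sets → ∀ a : R, rightColon J a ∈ sets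
  mem_of_colon : ∀ {J J' : Submodule Rᵐᵒᵖ R}, J' ∈ sets →
    (∀ a ∈ J', rightColon J a ∈ sets) → J ∈ sets

end Gabriel

/-! ### The symmetric ring of quotients -/

section Quotient

variable {R : Type u} [Ring R] (F : LeftGabrielFilter R) (G : RightGabrielFilter R)

/-- The torsion submodule of the bimodule `R` for the torsion theory induced by `F` and `G`, that
is, the intersection of the left and the right torsion submodule. -/
def torsion : Ideal R where
  carrier := {r | (∃ I ∈ F.sets, ∀ i ∈ I, i * r = 0) ∧ (∃ J ∈ G.sets, ∀ j ∈ J, r * j = 0)}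
  add_mem' := by
    rintro a b ⟨⟨I, hI, ha⟩, J, hJ, ha'⟩ ⟨⟨I', hI', hb⟩, J', hJ', hb'⟩
    refine ⟨⟨I ⊓ I', F.inf_mem hI hI', fun i hi => ?_⟩,
      J ⊓ J', G.inf_mem hJ hJ', fun j hj => ?_⟩
    · rw [mul_add, ha i hi.1, hb i hi.2, add_zero]
    · rw [add_mul, ha' j hj.1, hb' j hj.2, add_zero]
  zero_mem' := ⟨⟨⊤, F.top_mem, by simp⟩, ⊤, G.top_mem, by simp⟩
  smul_mem' := by
    rintro c a ⟨⟨I, hI, ha⟩, J, hJ, ha'⟩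
    refine ⟨⟨leftColon I c, F.colon_mem hI c, fun i hi => ?_⟩, J, hJ, fun j hj => ?_⟩
    · rw [smul_eq_mul, ← mul_assoc, ha _ hi]
    · rw [smul_eq_mul, mul_assoc, ha' j hj, mul_zero]

theorem mem_torsion {r : R} : r ∈ torsion F G ↔
    (∃ I ∈ F.sets, ∀ i ∈ I, i * r = 0) ∧ (∃ J ∈ G.sets, ∀ j ∈ J, r * j = 0) := Iff.rfl

instance : (torsion F G).IsTwoSided where
  mul_mem_of_left {a} b h := by
    obtain ⟨⟨I, hI, ha⟩, J, hJ, ha'⟩ := (mem_torsion F G).1 h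
    refine (mem_torsion F G).2 ⟨⟨I, hI, fun i hi => ?_⟩,
      rightColon J b, G.colon_mem hJ b, fun j hj => ?_⟩
    · rw [← mul_assoc, ha i hi, zero_mul]
    · rw [mul_assoc, ha' _ hj]

/-- `R` modulo its torsion. -/
abbrev Rbar : Type u := R ⧸ torsion F G

/-- The projection of `R` onto `Rbar`. -/
abbrev proj : R →+* Rbar F G := Ideal.Quotient.mk (torsion F G)

variable {F G}

theorem proj_surj (x : Rbar F G) : ∃ r, proj F G r = x := Ideal.Quotient.mk_surjective x

theorem proj_eq_zero {r : R} : proj F G r = 0 ↔ r ∈ torsion F G := Ideal.Quotient.eq_zero_iff_mem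

/-- `Rbar` is torsion-free. -/
theorem rbar_eq_zero {x : Rbar F G} {I : Submodule R R} (hI : I ∈ F.sets)
    {J : Submodule Rᵐᵒᵖ R} (hJ : J ∈ G.sets) (h : ∀ i ∈ I, proj F G i * x = 0)
    (h' : ∀ j ∈ J, x * proj F G j = 0) : x = 0 := by
  obtain ⟨r, rfl⟩ := proj_surj x
  rw [proj_eq_zero, mem_torsion]
  refine ⟨⟨leftColon ⊥ r, F.mem_of_colon hI fun a ha => ?_, fun i hi => by simpa using hi⟩,
    rightColon ⊥ r, G.mem_of_colon hJ fun a ha => ?_, fun j hj => by simpa using hj⟩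
  · have := h a ha
    rw [← map_mul, proj_eq_zero, mem_torsion] at this
    obtain ⟨⟨I', hI', h1⟩, -⟩ := this
    refine F.mem_of_le hI' fun i hi => ?_
    simpa [mul_assoc] using h1 i hi
  · have := h' a ha
    rw [← map_mul, proj_eq_zero, mem_torsion] at this
    obtain ⟨-, J', hJ', h1⟩ := this
    refine G.mem_of_le hJ' fun i hi => ?_
    simpa [mul_assoc] using h1 i hi

variable (F G)

/-- A compatible pair `(α, β)`: `α : I → Rbar` is a homomorphism of left `R`-modules with `I ∈ F`,
`β : J → Rbar` is a homomorphism of right `R`-modules with `J ∈ G`, and `α(i) j = i β(j)` for all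
`i ∈ I` and `j ∈ J`. -/
structure CompatiblePair where
  I : Submodule R R
  I_mem : I ∈ F.sets
  J : Submodule Rᵐᵒᵖ R
  J_mem : J ∈ G.sets
  α : I →+ Rbar F G
  α_smul : ∀ (r : R) (i : I), α (r • i) = proj F G r * α i
  β : J →+ Rbar F G
  β_smul : ∀ (r : R) (j : J), β (MulOpposite.op r • j) = β j * proj F G r
  compat : ∀ (i : I) (j : J), α i * proj F G (j : R) = proj F G (i : R) * β j

variable {F G}

namespace CompatiblePair

/-- Two compatible pairs are equivalent if their left components agree on some member of `F` and
their right components agree on some member of `G`. -/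
def Equivalent (p q : CompatiblePair F G) : Prop :=
  (∃ I' ∈ F.sets, ∃ (hp : I' ≤ p.I) (hq : I' ≤ q.I),
    ∀ (i : R) (hi : i ∈ I'), p.α ⟨i, hp hi⟩ = q.α ⟨i, hq hi⟩) ∧
  (∃ J' ∈ G.sets, ∃ (hp : J' ≤ p.J) (hq : J' ≤ q.J),
    ∀ (j : R) (hj : j ∈ J'), p.β ⟨j, hp hj⟩ = q.β ⟨j, hq hj⟩)

/-- Pairs agree on the whole common domains if they are equivalent. -/
theorem equivalent_iff {p q : CompatiblePair F G} : p.Equivalent q ↔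
    (∀ (i : R) (hp : i ∈ p.I) (hq : i ∈ q.I), p.α ⟨i, hp⟩ = q.α ⟨i, hq⟩) ∧
    (∀ (j : R) (hp : j ∈ p.J) (hq : j ∈ q.J), p.β ⟨j, hp⟩ = q.β ⟨j, hq⟩) := by
  constructor
  · rintro ⟨⟨I', hI', hIp, hIq, hα⟩, J', hJ', hJp, hJq, hβ⟩
    constructor
    · intro i hp hq
      rw [← sub_eq_zero]
      refine rbar_eq_zero (F.colon_mem hI' i) hJ' (fun r hr => ?_) (fun j hj => ?_)
      · have h1 := p.α_smul r ⟨i, hp⟩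
        have h2 := q.α_smul r ⟨i, hq⟩
        rw [mul_sub, ← h1, ← h2, sub_eq_zero]
        exact hα (r * i) hr
      · rw [sub_mul, sub_eq_zero]
        have h1 := p.compat ⟨i, hp⟩ ⟨j, hJp hj⟩
        have h2 := q.compat ⟨i, hq⟩ ⟨j, hJq hj⟩
        simp only at h1 h2
        rw [h1, h2, hβ j hj]
    · intro j hp hq
      rw [← sub_eq_zero]
      refine rbar_eq_zero hI' (G.colon_mem hJ' j) (fun i hi => ?_) (fun r hr => ?_)
      · rw [mul_sub, sub_eq_zero]
        have h1 := p.compat ⟨i, hIp hi⟩ ⟨j, hp⟩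
        have h2 := q.compat ⟨i, hIq hi⟩ ⟨j, hq⟩
        simp only at h1 h2
        rw [← h1, ← h2, hα i hi]
      · have h1 := p.β_smul r ⟨j, hp⟩
        have h2 := q.β_smul r ⟨j, hq⟩
        rw [sub_mul, ← h1, ← h2, sub_eq_zero]
        exact hβ (j * r) hr
  · rintro ⟨hα, hβ⟩
    exact ⟨⟨p.I ⊓ q.I, F.inf_mem p.I_mem q.I_mem, inf_le_left, inf_le_right,
        fun i hi => hα i hi.1 hi.2⟩,
      p.J ⊓ q.J, G.inf_mem p.J_mem q.J_mem, inf_le_left, inf_le_right,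
        fun j hj => hβ j hj.1 hj.2⟩

theorem Equivalent.refl (p : CompatiblePair F G) : p.Equivalent p :=
  equivalent_iff.2 ⟨fun _ _ _ => rfl, fun _ _ _ => rfl⟩

theorem Equivalent.symm {p q : CompatiblePair F G} (h : p.Equivalent q) : q.Equivalent p :=
  equivalent_iff.2 ⟨fun i hp hq => ((equivalent_iff.1 h).1 i hq hp).symm,
    fun j hp hq => ((equivalent_iff.1 h).2 j hq hp).symm⟩

theorem Equivalent.trans {p q t : CompatiblePair F G} (h : p.Equivalent q)
    (h' : q.Equivalent t) : p.Equivalent t := by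
  obtain ⟨⟨I₁, hI₁, a₁, b₁, c₁⟩, J₁, hJ₁, d₁, e₁, f₁⟩ := h
  obtain ⟨⟨I₂, hI₂, a₂, b₂, c₂⟩, J₂, hJ₂, d₂, e₂, f₂⟩ := h'
  exact ⟨⟨I₁ ⊓ I₂, F.inf_mem hI₁ hI₂, inf_le_left.trans a₁, inf_le_right.trans b₂,
      fun i hi => (c₁ i hi.1).trans (c₂ i hi.2)⟩,
    J₁ ⊓ J₂, G.inf_mem hJ₁ hJ₂, inf_le_left.trans d₁, inf_le_right.trans e₂,
      fun j hj => (f₁ j hj.1).trans (f₂ j hj.2)⟩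

variable (F G) in
/-- Equivalence of compatible pairs. -/
def setoid : Setoid (CompatiblePair F G) where
  r := Equivalent
  iseqv := ⟨Equivalent.refl, Equivalent.symm, Equivalent.trans⟩

/-- `α` kills the torsion elements of `I`. -/
theorem α_eq_zero (p : CompatiblePair F G) {i : R} (hi : i ∈ p.I) (h : proj F G i = 0) :
    p.α ⟨i, hi⟩ = 0 := by
  obtain ⟨⟨I', hI', h1⟩, -⟩ := (mem_torsion F G).1 (proj_eq_zero.1 h)
  refine rbar_eq_zero hI' p.J_mem (fun r hr => ?_) (fun j hj => ?_)
  · rw [← p.α_smul]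
    have : r • (⟨i, hi⟩ : p.I) = 0 := Subtype.ext (h1 r hr)
    rw [this, map_zero]
  · have := p.compat ⟨i, hi⟩ ⟨j, hj⟩
    simp only at this
    rw [this, h, zero_mul]

/-- `β` kills the torsion elements of `J`. -/
theorem β_eq_zero (p : CompatiblePair F G) {j : R} (hj : j ∈ p.J) (h : proj F G j = 0) :
    p.β ⟨j, hj⟩ = 0 := by
  obtain ⟨-, J', hJ', h1⟩ := (mem_torsion F G).1 (proj_eq_zero.1 h)
  refine rbar_eq_zero p.I_mem hJ' (fun i hi => ?_) (fun r hr => ?_)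
  · have := p.compat ⟨i, hi⟩ ⟨j, hj⟩
    simp only at this
    rw [← this, h, mul_zero]
  · rw [← p.β_smul]
    have : MulOpposite.op r • (⟨j, hj⟩ : p.J) = 0 := Subtype.ext (h1 r hr)
    rw [this, map_zero]

theorem α_congr (p : CompatiblePair F G) {i i' : p.I} (h : proj F G (i : R) = proj F G (i' : R)) :
    p.α i = p.α i' := by
  rw [← sub_eq_zero, ← map_sub]
  exact p.α_eq_zero (i - i').2 (by simpa [sub_eq_zero] using h)

theorem β_congr (p : CompatiblePair F G) {j j' : p.J} (h : proj F G (j : R) = proj F G (j' : R)) :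
    p.β j = p.β j' := by
  rw [← sub_eq_zero, ← map_sub]
  exact p.β_eq_zero (j - j').2 (by simpa [sub_eq_zero] using h)

variable (F G) in
/-- The pair (right multiplication by `a`, left multiplication by `a`). -/
def ofElem (a : R) : CompatiblePair F G where
  I := ⊤
  I_mem := F.top_mem
  J := ⊤
  J_mem := G.top_mem
  α :=
    { toFun := fun i => proj F G (i * a)
      map_zero' := by simp
      map_add' := fun x y => by simp [add_mul] }
  α_smul := fun r i => by simp [mul_assoc]
  β :=
    { toFun := fun j => proj F G (a * j)
      map_zero' := by simp
      map_add' := fun x y => by simp [mul_add] }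
  β_smul := fun r j => by simp [mul_assoc]
  compat := fun i j => by simp [mul_assoc]

/-- Sum of pairs, on the intersections of the domains. -/
def add (p q : CompatiblePair F G) : CompatiblePair F G where
  I := p.I ⊓ q.I
  I_mem := F.inf_mem p.I_mem q.I_mem
  J := p.J ⊓ q.J
  J_mem := G.inf_mem p.J_mem q.J_mem
  α := p.α.comp (Submodule.inclusion inf_le_left).toAddMonoidHom +
    q.α.comp (Submodule.inclusion inf_le_right).toAddMonoidHom
  α_smul := fun r i => by
    have h1 := p.α_smul r ⟨i, i.2.1⟩
    have h2 := q.α_smul r ⟨i, i.2.2⟩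
    exact (congrArg₂ (· + ·) h1 h2).trans (mul_add _ _ _).symm
  β := p.β.comp (Submodule.inclusion inf_le_left).toAddMonoidHom +
    q.β.comp (Submodule.inclusion inf_le_right).toAddMonoidHom
  β_smul := fun r j => by
    have h1 := p.β_smul r ⟨j, j.2.1⟩
    have h2 := q.β_smul r ⟨j, j.2.2⟩
    exact (congrArg₂ (· + ·) h1 h2).trans (add_mul _ _ _).symm
  compat := fun i j => by
    have h1 := p.compat ⟨i, i.2.1⟩ ⟨j, j.2.1⟩
    have h2 := q.compat ⟨i, i.2.2⟩ ⟨j, j.2.2⟩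
    exact (add_mul _ _ _).trans ((congrArg₂ (· + ·) h1 h2).trans (mul_add _ _ _).symm)

/-- The negative of a pair. -/
def neg (p : CompatiblePair F G) : CompatiblePair F G where
  I := p.I
  I_mem := p.I_mem
  J := p.J
  J_mem := p.J_mem
  α := -p.α
  α_smul := fun r i => by simp [p.α_smul]
  β := -p.β
  β_smul := fun r j => by simp [p.β_smul]
  compat := fun i j => by simp [p.compat]

@[simp] theorem ofElem_α (a : R) (i : (ofElem F G a).I) : (ofElem F G a).α i = proj F G (i * a) := rfl

@[simp] theorem ofElem_β (a : R) (j : (ofElem F G a).J) : (ofElem F G a).β j = proj F G (a * j) := rfl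

@[simp] theorem add_α (p q : CompatiblePair F G) (i : (add p q).I) :
    (add p q).α i = p.α ⟨i, i.2.1⟩ + q.α ⟨i, i.2.2⟩ := rfl

@[simp] theorem add_β (p q : CompatiblePair F G) (j : (add p q).J) :
    (add p q).β j = p.β ⟨j, j.2.1⟩ + q.β ⟨j, j.2.2⟩ := rfl

@[simp] theorem neg_α (p : CompatiblePair F G) (i : p.I) : (neg p).α i = -p.α i := rfl

@[simp] theorem neg_β (p : CompatiblePair F G) (j : p.J) : (neg p).β j = -p.β j := rfl

/-- The left ideal of all `i ∈ p.I` for which `p.α i` is the residue class of an element of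
`q.I`. -/
def mulI (p q : CompatiblePair F G) : Submodule R R where
  carrier := {i | ∃ (hi : i ∈ p.I) (k : q.I), proj F G (k : R) = p.α ⟨i, hi⟩}
  add_mem' := by
    rintro a b ⟨ha, k, hk⟩ ⟨hb, l, hl⟩
    refine ⟨p.I.add_mem ha hb, k + l, ?_⟩
    have : (⟨a + b, p.I.add_mem ha hb⟩ : p.I) = ⟨a, ha⟩ + ⟨b, hb⟩ := rfl
    rw [this, map_add, Submodule.coe_add, map_add, hk, hl]
  zero_mem' := ⟨p.I.zero_mem, 0, by
    have : (⟨0, p.I.zero_mem⟩ : p.I) = 0 := rfl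
    rw [this, map_zero, Submodule.coe_zero, map_zero]⟩
  smul_mem' := by
    rintro c a ⟨ha, k, hk⟩
    refine ⟨p.I.smul_mem c ha, c • k, ?_⟩
    have : (⟨c • a, p.I.smul_mem c ha⟩ : p.I) = c • ⟨a, ha⟩ := rfl
    rw [this, p.α_smul, Submodule.coe_smul, smul_eq_mul, map_mul, hk]

/-- The right ideal of all `j ∈ q.J` for which `q.β j` is the residue class of an element of
`p.J`. -/
def mulJ (p q : CompatiblePair F G) : Submodule Rᵐᵒᵖ R where
  carrier := {j | ∃ (hj : j ∈ q.J) (k : p.J), proj F G (k : R) = q.β ⟨j, hj⟩}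
  add_mem' := by
    rintro a b ⟨ha, k, hk⟩ ⟨hb, l, hl⟩
    refine ⟨q.J.add_mem ha hb, k + l, ?_⟩
    have : (⟨a + b, q.J.add_mem ha hb⟩ : q.J) = ⟨a, ha⟩ + ⟨b, hb⟩ := rfl
    rw [this, map_add, Submodule.coe_add, map_add, hk, hl]
  zero_mem' := ⟨q.J.zero_mem, 0, by
    have : (⟨0, q.J.zero_mem⟩ : q.J) = 0 := rfl
    rw [this, map_zero, Submodule.coe_zero, map_zero]⟩
  smul_mem' := by
    rintro c a ⟨ha, k, hk⟩
    induction c using MulOpposite.rec' with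
    | h c =>
      refine ⟨q.J.smul_mem _ ha, MulOpposite.op c • k, ?_⟩
      have : (⟨MulOpposite.op c • a, q.J.smul_mem _ ha⟩ : q.J) = MulOpposite.op c • ⟨a, ha⟩ := rfl
      rw [this, q.β_smul, Submodule.coe_smul, op_smul_eq_mul, map_mul, hk]

theorem mulI_mem (p q : CompatiblePair F G) : mulI p q ∈ F.sets := by
  refine F.mem_of_colon p.I_mem fun a ha => ?_
  obtain ⟨b, hb⟩ := proj_surj (p.α ⟨a, ha⟩)
  refine F.mem_of_le (F.colon_mem q.I_mem b) fun r hr => ?_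
  refine ⟨p.I.smul_mem r ha, ⟨r * b, hr⟩, ?_⟩
  have : (⟨r • a, p.I.smul_mem r ha⟩ : p.I) = r • ⟨a, ha⟩ := rfl
  exact ((map_mul _ _ _).trans (by rw [hb])).trans (p.α_smul r ⟨a, ha⟩).symm

theorem mulJ_mem (p q : CompatiblePair F G) : mulJ p q ∈ G.sets := by
  refine G.mem_of_colon q.J_mem fun a ha => ?_
  obtain ⟨b, hb⟩ := proj_surj (q.β ⟨a, ha⟩)
  refine G.mem_of_le (G.colon_mem p.J_mem b) fun r hr => ?_
  refine ⟨q.J.smul_mem (MulOpposite.op r) ha, ⟨b * r, hr⟩, ?_⟩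
  exact ((map_mul _ _ _).trans (by rw [hb])).trans (q.β_smul r ⟨a, ha⟩).symm

/-- An element `k` of `q.I` with residue class `p.α i`. -/
noncomputable def mulLiftI (p q : CompatiblePair F G) (i : mulI p q) : q.I := i.2.choose_spec.choose

theorem mulLiftI_spec (p q : CompatiblePair F G) (i : mulI p q) :
    proj F G (mulLiftI p q i : R) = p.α ⟨i, i.2.choose⟩ := i.2.choose_spec.choose_spec

/-- An element `k` of `p.J` with residue class `q.β j`. -/
noncomputable def mulLiftJ (p q : CompatiblePair F G) (j : mulJ p q) : p.J := j.2.choose_spec.choose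

theorem mulLiftJ_spec (p q : CompatiblePair F G) (j : mulJ p q) :
    proj F G (mulLiftJ p q j : R) = q.β ⟨j, j.2.choose⟩ := j.2.choose_spec.choose_spec

/-- The product of pairs. An element `x` of the ring of quotients corresponds to the maps `i ↦ i x`
and `j ↦ x j`, so the product of `p` and `q` has the components `q.α ∘ p.α` and `p.β ∘ q.β`, where
a residue class is lifted to the domain of the outer map before that map is applied. -/
noncomputable def mul (p q : CompatiblePair F G) : CompatiblePair F G where
  I := mulI p q
  I_mem := mulI_mem p q
  J := mulJ p q
  J_mem := mulJ_mem p q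
  α := AddMonoidHom.mk' (fun i => q.α (mulLiftI p q i)) fun a b => by
    rw [← map_add]
    refine q.α_congr ?_
    rw [Submodule.coe_add, map_add, mulLiftI_spec, mulLiftI_spec, mulLiftI_spec, ← map_add]
    rfl
  α_smul := fun r i => by
    simp only [AddMonoidHom.mk'_apply]
    rw [← q.α_smul]
    refine q.α_congr ?_
    rw [Submodule.coe_smul, smul_eq_mul, map_mul, mulLiftI_spec, mulLiftI_spec, ← p.α_smul]
    rfl
  β := AddMonoidHom.mk' (fun j => p.β (mulLiftJ p q j)) fun a b => by
    rw [← map_add]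
    refine p.β_congr ?_
    rw [Submodule.coe_add, map_add, mulLiftJ_spec, mulLiftJ_spec, mulLiftJ_spec, ← map_add]
    rfl
  β_smul := fun r j => by
    simp only [AddMonoidHom.mk'_apply]
    rw [← p.β_smul]
    refine p.β_congr ?_
    rw [Submodule.coe_smul, op_smul_eq_mul, map_mul, mulLiftJ_spec, mulLiftJ_spec,
      ← q.β_smul]
    rfl
  compat := fun i j => by
    simp only [AddMonoidHom.mk'_apply]
    have h1 := q.compat (mulLiftI p q i) ⟨j, j.2.choose⟩
    have h2 := p.compat ⟨i, i.2.choose⟩ (mulLiftJ p q j)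
    rw [mulLiftI_spec, ← mulLiftJ_spec] at h1
    exact h1.trans h2

theorem mul_α (p q : CompatiblePair F G) {i : R} (hi : i ∈ (mul p q).I) (hp : i ∈ p.I) (k : q.I)
    (hk : proj F G (k : R) = p.α ⟨i, hp⟩) : (mul p q).α ⟨i, hi⟩ = q.α k :=
  q.α_congr ((mulLiftI_spec p q ⟨i, hi⟩).trans hk.symm)

theorem mul_β (p q : CompatiblePair F G) {j : R} (hj : j ∈ (mul p q).J) (hq : j ∈ q.J) (k : p.J)
    (hk : proj F G (k : R) = q.β ⟨j, hq⟩) : (mul p q).β ⟨j, hj⟩ = p.β k :=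
  p.β_congr ((mulLiftJ_spec p q ⟨j, hj⟩).trans hk.symm)

/-- Equivalent pairs take equal values at elements with the same residue class. -/
theorem Equivalent.α_eq {p q : CompatiblePair F G} (h : p.Equivalent q) (k : p.I) (l : q.I)
    (hkl : proj F G (k : R) = proj F G (l : R)) : p.α k = q.α l := by
  obtain ⟨hα, hβ⟩ := equivalent_iff.1 h
  rw [← sub_eq_zero]
  refine rbar_eq_zero (F.colon_mem q.I_mem (k : R)) (G.inf_mem p.J_mem q.J_mem)
    (fun r hr => ?_) (fun j hj => ?_)
  · rw [mul_sub, ← p.α_smul, ← q.α_smul, sub_eq_zero]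
    refine (hα (r * k) (r • k).2 hr).trans (q.α_congr ?_)
    simp [hkl]
  · have h1 := p.compat k ⟨j, hj.1⟩
    have h2 := q.compat l ⟨j, hj.2⟩
    simp only at h1 h2
    rw [sub_mul, h1, h2, hkl, hβ j hj.1 hj.2, sub_self]

/-- Equivalent pairs take equal values at elements with the same residue class. -/
theorem Equivalent.β_eq {p q : CompatiblePair F G} (h : p.Equivalent q) (k : p.J) (l : q.J)
    (hkl : proj F G (k : R) = proj F G (l : R)) : p.β k = q.β l := by
  obtain ⟨hα, hβ⟩ := equivalent_iff.1 h
  rw [← sub_eq_zero]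
  refine rbar_eq_zero (F.inf_mem p.I_mem q.I_mem) (G.colon_mem q.J_mem (k : R))
    (fun i hi => ?_) (fun r hr => ?_)
  · have h1 := p.compat ⟨i, hi.1⟩ k
    have h2 := q.compat ⟨i, hi.2⟩ l
    simp only at h1 h2
    rw [mul_sub, ← h1, ← h2, hkl, hα i hi.1 hi.2, sub_self]
  · rw [sub_mul, ← p.β_smul, ← q.β_smul, sub_eq_zero]
    refine (hβ (k * r) (MulOpposite.op r • k).2 hr).trans (q.β_congr ?_)
    simp [hkl]

theorem add_congr {p p' q q' : CompatiblePair F G} (h : p.Equivalent p') (h' : q.Equivalent q') :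
    (add p q).Equivalent (add p' q') :=
  equivalent_iff.2 ⟨fun i hi hi' => congrArg₂ (· + ·) ((equivalent_iff.1 h).1 i hi.1 hi'.1)
      ((equivalent_iff.1 h').1 i hi.2 hi'.2),
    fun j hj hj' => congrArg₂ (· + ·) ((equivalent_iff.1 h).2 j hj.1 hj'.1)
      ((equivalent_iff.1 h').2 j hj.2 hj'.2)⟩

theorem neg_congr {p p' : CompatiblePair F G} (h : p.Equivalent p') :
    (neg p).Equivalent (neg p') :=
  equivalent_iff.2 ⟨fun i hi hi' => congrArg Neg.neg ((equivalent_iff.1 h).1 i hi hi'),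
    fun j hj hj' => congrArg Neg.neg ((equivalent_iff.1 h).2 j hj hj')⟩

theorem mul_congr {p p' q q' : CompatiblePair F G} (h : p.Equivalent p') (h' : q.Equivalent q') :
    (mul p q).Equivalent (mul p' q') := by
  refine equivalent_iff.2 ⟨fun i hi hi' => ?_, fun j hj hj' => ?_⟩
  · obtain ⟨hp, k, hk⟩ := id hi
    obtain ⟨hp', k', hk'⟩ := id hi'
    rw [mul_α p q hi hp k hk, mul_α p' q' hi' hp' k' hk']
    exact h'.α_eq k k' (hk.trans (((equivalent_iff.1 h).1 i hp hp').trans hk'.symm))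
  · obtain ⟨hq, k, hk⟩ := id hj
    obtain ⟨hq', k', hk'⟩ := id hj'
    rw [mul_β p q hj hq k hk, mul_β p' q' hj' hq' k' hk']
    exact h.β_eq k k' (hk.trans (((equivalent_iff.1 h').2 j hq hq').trans hk'.symm))

theorem mul_assoc_equiv (p q t : CompatiblePair F G) :
    (mul (mul p q) t).Equivalent (mul p (mul q t)) := by
  refine equivalent_iff.2 ⟨fun i hi hi' => ?_, fun j hj hj' => ?_⟩
  · obtain ⟨hpq, k, hk⟩ := id hi
    obtain ⟨hp, k', hk'⟩ := id hi'
    obtain ⟨hq, m, hm⟩ := id k'.2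
    rw [mul_α _ _ hi hpq k hk, mul_α _ _ hi' hp k' hk', mul_α q t k'.2 hq m hm]
    refine t.α_congr (hk.trans ?_)
    rw [mul_α p q hpq hp ⟨k', hq⟩ hk', hm]
  · obtain ⟨ht, k, hk⟩ := id hj
    obtain ⟨hqt, k', hk'⟩ := id hj'
    obtain ⟨hq, m, hm⟩ := id k.2
    rw [mul_β _ _ hj ht k hk, mul_β _ _ hj' hqt k' hk', mul_β p q k.2 hq m hm]
    refine p.β_congr (Eq.trans ?_ hk'.symm)
    rw [mul_β q t hqt ht ⟨k, hq⟩ hk, hm]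

theorem one_mul_equiv (p : CompatiblePair F G) : (mul (ofElem F G 1) p).Equivalent p := by
  refine equivalent_iff.2 ⟨fun i hi hi' => ?_, fun j hj hj' => ?_⟩
  · exact mul_α _ _ hi trivial ⟨i, hi'⟩ (by simp)
  · obtain ⟨hq, k, hk⟩ := id hj
    rw [mul_β _ _ hj hq k hk, ← hk]
    simp

theorem mul_one_equiv (p : CompatiblePair F G) : (mul p (ofElem F G 1)).Equivalent p := by
  refine equivalent_iff.2 ⟨fun i hi hi' => ?_, fun j hj hj' => ?_⟩
  · obtain ⟨hq, k, hk⟩ := id hi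
    rw [mul_α _ _ hi hq k hk, ← hk]
    simp
  · exact mul_β _ _ hj trivial ⟨j, hj'⟩ (by simp)

theorem mul_add_equiv (p q t : CompatiblePair F G) :
    (mul p (add q t)).Equivalent (add (mul p q) (mul p t)) := by
  refine equivalent_iff.2 ⟨fun i hi hi' => ?_, fun j hj hj' => ?_⟩
  · obtain ⟨hp, k, hk⟩ := id hi
    rw [mul_α _ _ hi hp k hk]
    refine Eq.trans ?_ (congrArg₂ (· + ·) (mul_α p q hi'.1 hp ⟨k, k.2.1⟩ hk)
      (mul_α p t hi'.2 hp ⟨k, k.2.2⟩ hk)).symm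
    rfl
  · obtain ⟨hqt, k, hk⟩ := id hj
    obtain ⟨hq, l, hl⟩ := id hj'.1
    obtain ⟨ht, m, hm⟩ := id hj'.2
    rw [mul_β _ _ hj hqt k hk]
    refine Eq.trans ?_ (congrArg₂ (· + ·) (mul_β p q hj'.1 hq l hl)
      (mul_β p t hj'.2 ht m hm)).symm
    rw [← map_add]
    refine p.β_congr (hk.trans ?_)
    rw [Submodule.coe_add, map_add, hl, hm]
    rfl

theorem add_mul_equiv (p q t : CompatiblePair F G) :
    (mul (add p q) t).Equivalent (add (mul p t) (mul q t)) := by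
  refine equivalent_iff.2 ⟨fun i hi hi' => ?_, fun j hj hj' => ?_⟩
  · obtain ⟨hpq, k, hk⟩ := id hi
    obtain ⟨hp, l, hl⟩ := id hi'.1
    obtain ⟨hq, m, hm⟩ := id hi'.2
    rw [mul_α _ _ hi hpq k hk]
    refine Eq.trans ?_ (congrArg₂ (· + ·) (mul_α p t hi'.1 hp l hl)
      (mul_α q t hi'.2 hq m hm)).symm
    rw [← map_add]
    refine t.α_congr (hk.trans ?_)
    rw [Submodule.coe_add, map_add, hl, hm]
    rfl
  · obtain ⟨ht, k, hk⟩ := id hj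
    rw [mul_β _ _ hj ht k hk]
    refine Eq.trans ?_ (congrArg₂ (· + ·) (mul_β p t hj'.1 ht ⟨k, k.2.1⟩ hk)
      (mul_β q t hj'.2 ht ⟨k, k.2.2⟩ hk)).symm
    rfl

end CompatiblePair

open CompatiblePair

variable (F G) in
/-- The symmetric ring of quotients of `R` with respect to `F` and `G`: the equivalence classes of
compatible pairs. -/
def SymmetricQuotient : Type u := Quotient (CompatiblePair.setoid F G)

namespace SymmetricQuotient

instance : Zero (SymmetricQuotient F G) := ⟨Quotient.mk _ (ofElem F G 0)⟩

instance : One (SymmetricQuotient F G) := ⟨Quotient.mk _ (ofElem F G 1)⟩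

instance : Add (SymmetricQuotient F G) :=
  ⟨Quotient.map₂ CompatiblePair.add fun _ _ h _ _ h' => add_congr h h'⟩

instance : Neg (SymmetricQuotient F G) :=
  ⟨Quotient.map CompatiblePair.neg fun _ _ h => neg_congr h⟩

noncomputable instance : Mul (SymmetricQuotient F G) :=
  ⟨Quotient.map₂ CompatiblePair.mul fun _ _ h _ _ h' => mul_congr h h'⟩

noncomputable instance : Ring (SymmetricQuotient F G) where
  nsmul := nsmulRec
  zsmul := zsmulRec
  add_assoc := by
    rintro ⟨p⟩ ⟨q⟩ ⟨t⟩
    exact Quotient.sound (equivalent_iff.2 ⟨fun i _ _ => add_assoc _ _ _,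
      fun j _ _ => add_assoc _ _ _⟩)
  add_comm := by
    rintro ⟨p⟩ ⟨q⟩
    exact Quotient.sound (equivalent_iff.2 ⟨fun i _ _ => add_comm _ _, fun j _ _ => add_comm _ _⟩)
  zero_add := by
    rintro ⟨p⟩
    refine Quotient.sound (equivalent_iff.2 ⟨fun i hi hi' => ?_, fun j hj hj' => ?_⟩) <;>
      simp
  add_zero := by
    rintro ⟨p⟩
    refine Quotient.sound (equivalent_iff.2 ⟨fun i hi hi' => ?_, fun j hj hj' => ?_⟩) <;>
      simp
  neg_add_cancel := by
    rintro ⟨p⟩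
    refine Quotient.sound (equivalent_iff.2 ⟨fun i hi hi' => ?_, fun j hj hj' => ?_⟩) <;>
      simp only [add_α, add_β, ofElem_α, ofElem_β, mul_zero, zero_mul, map_zero]
    · exact neg_add_cancel _
    · exact neg_add_cancel _
  mul_assoc := by
    rintro ⟨p⟩ ⟨q⟩ ⟨t⟩
    exact Quotient.sound (mul_assoc_equiv p q t)
  one_mul := by
    rintro ⟨p⟩
    exact Quotient.sound (one_mul_equiv p)
  mul_one := by
    rintro ⟨p⟩
    exact Quotient.sound (mul_one_equiv p)
  left_distrib := by
    rintro ⟨p⟩ ⟨q⟩ ⟨t⟩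
    exact Quotient.sound (mul_add_equiv p q t)
  right_distrib := by
    rintro ⟨p⟩ ⟨q⟩ ⟨t⟩
    exact Quotient.sound (add_mul_equiv p q t)
  zero_mul := by
    rintro ⟨p⟩
    refine Quotient.sound (equivalent_iff.2 ⟨fun i hi hi' => ?_, fun j hj hj' => ?_⟩)
    · exact (mul_α _ _ hi trivial 0 (by simp)).trans (by simp)
    · obtain ⟨hq, k, hk⟩ := id hj
      rw [mul_β _ _ hj hq k hk]
      simp
  mul_zero := by
    rintro ⟨p⟩
    refine Quotient.sound (equivalent_iff.2 ⟨fun i hi hi' => ?_, fun j hj hj' => ?_⟩)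
    · obtain ⟨hq, k, hk⟩ := id hi
      rw [mul_α _ _ hi hq k hk]
      simp
    · exact (mul_β _ _ hj trivial 0 (by simp)).trans (by simp)

variable (F G) in
/-- The canonical map `q_R` from `R` to its symmetric ring of quotients. -/
noncomputable def canonicalMap : R →+* SymmetricQuotient F G where
  toFun := fun r => Quotient.mk _ (ofElem F G r)
  map_zero' := rfl
  map_one' := rfl
  map_add' := fun a b => Quotient.sound (equivalent_iff.2
    ⟨fun i _ _ => by simp [mul_add],
      fun j _ _ => by simp [add_mul]⟩)
  map_mul' := fun a b => Quotient.sound (equivalent_iff.2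
    ⟨fun i _ hi => Eq.symm <| (mul_α _ _ hi trivial ⟨i * a, trivial⟩ (by simp)).trans
        (by simp [mul_assoc]),
      fun j _ hj => Eq.symm <| (mul_β _ _ hj trivial ⟨b * j, trivial⟩ (by simp)).trans
        (by simp [mul_assoc])⟩)

end SymmetricQuotient

end Quotient

/-! ### The families of ideals and the element-wise conditions attached to a homomorphism -/

section Conditions

variable {R : Type u} {S : Type v} [Ring R] [Ring S] (f : R →ₙ+* S)

/-- The left ideals `I` of `R` with `S f(I) = S`. -/
def leftFamily : Set (Submodule R R) :=
  {I | Submodule.span S (f '' (I : Set R)) = ⊤}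

/-- The right ideals `J` of `R` with `f(J) S = S`. -/
def rightFamily : Set (Submodule Rᵐᵒᵖ R) :=
  {J | Submodule.span Sᵐᵒᵖ (f '' (J : Set R)) = ⊤}

/-- The two families are Gabriel filters, and `S` is isomorphic to the corresponding symmetric ring
of quotients by an isomorphism that carries `f` to the canonical map. -/
def IsSymmetricQuotientOfFamilies : Prop :=
  ∃ (F : LeftGabrielFilter R) (G : RightGabrielFilter R),
    F.sets = leftFamily f ∧ G.sets = rightFamily f ∧
      ∃ g : S ≃+* SymmetricQuotient F G, ∀ r : R, g (f r) = SymmetricQuotient.canonicalMap F G r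

end Conditions

end SymQuot

/-!
Each of the three conditions forces `f 1 = 1`, so `f` may be taken to be a homomorphism of rings with
identity. The element-wise condition then splits into a left half, `IsLeftFractional f`, and a right
half, which is the left half for the opposite homomorphism `f.op`, so that the main one-sided
arguments are carried out on the left and transported by `f ↦ f.op`. Call a set `A ⊆ R` large if
`S f(A) = S` (`Generates f A`).

Flatness is handled through characters. Let `C = Hom_ℤ(S, ℚ/ℤ)`, a left `R`-module by
`(r φ)(s) = φ(s f(r))`. By Lambek's criterion (`isRightFlat_iff_baer`, `isLeftFlat_iff_baer`), `S` is
right flat if and only if `C` satisfies Baer's criterion. Besides replacing tensor products by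
homomorphisms, this removes the bound on the universe of the modules on which flatness is tested.

*From a flat epimorphism to fractions* (`IsRingEpi.isLeftFractional`). Along an epimorphism every
`R`-linear map between `S`-modules is `S`-linear (`IsRingEpi.map_smul`). If the denominators of `s`
are not large, a character of `S` that is nonzero at `1` kills `S f(r)` for all denominators `r` of
`s`, and injectivity of `C` gives an `R`-linear map `Φ : S/f(R) → C` with `Φ(s)(1) ≠ 0`
(`exists_linearMap_apply_one_ne_zero`). The composite `S → C` is `S`-linear and vanishes at `1`,
so it is zero, a contradiction. The same map, for `R` in place of `S/f(R)`, shows that elements of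
the kernel have large annihilators.

*From fractions to a flat epimorphism.* That `f` is an epimorphism is a calculation with fractions
(`IsLeftFractional.isRingEpi`). An `R`-linear `g : I → C` extends to `R` once
`∑ s f(i) ↦ ∑ g(i)(s)` is a well-defined character on `S f(I)`, and it is, because multiplication by
a common denominator moves a relation `∑ s f(i) = 0` into the kernel of `f`, whose elements have
large annihilators (`IsLeftFractional.baer`).

*Fractions and the symmetric ring of quotients.* Under the two fraction conditions the large
one-sided ideals form Gabriel filters, the torsion ideal is the kernel of `f`, and `s ∈ S` gives the
compatible pair of right and left multiplication by `s`, defined on its denominators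
(`Represents.exists_pair`); conversely every compatible pair arises from a unique `s`
(`Represents.exists_elem`). In the other direction, if `x` is the class of `(α, β)` and `α(i)` is the
residue class of `a`, then `q(i) x = q(a)` (`canonicalMap_mul_classOf`), so the domain of `α`
consists of left denominators of `x`, and likewise for `β` on the right.
-/

namespace SymQuot

/-! ### Subsets that generate the unit ideal -/

section Generation

variable {R : Type u} {S : Type v} [Ring R] [Ring S]

/-- The left ideal of `S` generated by `f(A)` is all of `S`. -/
def Generates (f : R →+* S) (A : Set R) : Prop :=
  Ideal.span (f '' A) = ⊤

variable {f : R →+* S}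

theorem Generates.mono {A B : Set R} (h : Generates f A) (hAB : A ⊆ B) : Generates f B :=
  top_le_iff.1 (h.ge.trans (Ideal.span_mono (Set.image_mono hAB)))

theorem generates_of_one_mem {A : Set R}
    (h : ∀ L : Ideal S, (∀ a ∈ A, f a ∈ L) → (1 : S) ∈ L) : Generates f A :=
  (Ideal.eq_top_iff_one _).2 (h _ fun a ha => Ideal.subset_span ⟨a, ha, rfl⟩)

theorem Generates.one_mem {A : Set R} (h : Generates f A) {L : Ideal S}
    (hL : ∀ a ∈ A, f a ∈ L) : (1 : S) ∈ L := by
  have : Ideal.span (f '' A) ≤ L := Ideal.span_le.2 (by rintro _ ⟨a, ha, rfl⟩; exact hL a ha)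
  exact this (h ▸ Submodule.mem_top)

theorem generates_univ : Generates f Set.univ :=
  generates_of_one_mem fun _ h => by simpa using h 1 trivial

/-- The transitivity axiom of a Gabriel filter, for arbitrary subsets; it needs no assumption on
`f`. -/
theorem Generates.trans {A B : Set R} (hB : Generates f B)
    (h : ∀ b ∈ B, Generates f {r | r * b ∈ A}) : Generates f A := by
  refine generates_of_one_mem fun L hL => hB.one_mem fun b hb => ?_
  have := (h b hb).one_mem (L := Submodule.comap (LinearMap.toSpanSingleton S S (f b)) L) fun r hr => by
    simpa using hL _ hr
  simpa using this

theorem Generates.eq_zero_of_mul {A : Set R} (h : Generates f A) {x : S}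
    (hx : ∀ a ∈ A, f a * x = 0) : x = 0 := by
  have := h.one_mem (L := LinearMap.ker (LinearMap.toSpanSingleton S S x)) fun a ha => by
    simpa using hx a ha
  simpa using this

theorem Generates.addMonoidHom_eq_zero {X : Type*} [AddCommGroup X] {A : Set R}
    (h : Generates f A) {χ : S →+ X} (hχ : ∀ a ∈ A, ∀ t, χ (t * f a) = 0) : χ = 0 := by
  let L : Ideal S :=
    { carrier := {x | ∀ t, χ (t * x) = 0}
      add_mem' := fun {x y} hx hy t => by rw [mul_add, map_add, hx t, hy t, add_zero]
      zero_mem' := fun t => by simp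
      smul_mem' := fun c x hx t => by rw [smul_eq_mul, ← mul_assoc]; exact hx _ }
  ext t
  simpa using h.one_mem (L := L) hχ t

theorem generates_iff_exists_sum {A : Set R} : Generates f A ↔
    ∃ (n : ℕ) (r : Fin n → R) (t : Fin n → S), (∀ i, r i ∈ A) ∧ ∑ i, t i * f (r i) = 1 := by
  constructor
  · intro h
    have h1 : (1 : S) ∈ Submodule.span S (f '' A) := by
      rw [show Submodule.span S (f '' A) = ⊤ from h]; trivial
    obtain ⟨n, t, g, hg⟩ := Submodule.mem_span_set'.1 h1
    choose r hr hr' using fun i => (g i).2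
    refine ⟨n, r, t, hr, ?_⟩
    simpa [hr'] using hg
  · rintro ⟨n, r, t, hr, h⟩
    refine generates_of_one_mem fun L hL => ?_
    rw [← h]
    exact L.sum_mem fun i _ => L.mul_mem_left _ (hL _ (hr i))

/-- `Generates` for the opposite homomorphism, spelled out in `R` and `S`: `f(A) S = S`. -/
theorem generates_op_iff_exists_sum {A : Set R} :
    Generates f.op (MulOpposite.unop ⁻¹' A) ↔
    ∃ (n : ℕ) (r : Fin n → R) (t : Fin n → S), (∀ i, r i ∈ A) ∧ ∑ i, f (r i) * t i = 1 := by
  rw [generates_iff_exists_sum]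
  constructor
  · rintro ⟨n, r, t, hr, h⟩
    refine ⟨n, fun i => (r i).unop, fun i => (t i).unop, hr, ?_⟩
    simpa using congrArg MulOpposite.unop h
  · rintro ⟨n, r, t, hr, h⟩
    refine ⟨n, fun i => .op (r i), fun i => .op (t i), hr, ?_⟩
    apply MulOpposite.unop_injective
    simpa using h

theorem span_op_eq_top_iff {A : Set R} :
    Submodule.span Sᵐᵒᵖ (f '' A) = ⊤ ↔ Generates f.op (MulOpposite.unop ⁻¹' A) := by
  rw [generates_op_iff_exists_sum]
  constructor
  · intro h
    have h1 : (1 : S) ∈ Submodule.span Sᵐᵒᵖ (f '' A) := h ▸ Submodule.mem_top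
    obtain ⟨n, t, g, hg⟩ := Submodule.mem_span_set'.1 h1
    choose r hr hr' using fun i => (g i).2
    refine ⟨n, r, fun i => (t i).unop, hr, ?_⟩
    simpa [hr', MulOpposite.smul_eq_mul_unop] using hg
  · rintro ⟨n, r, t, hr, h⟩
    refine eq_top_iff.2 fun x _ => ?_
    rw [← one_mul x, ← h, Finset.sum_mul]
    refine Submodule.sum_mem _ fun i _ => ?_
    rw [mul_assoc]
    exact Submodule.smul_mem _ (MulOpposite.op (t i * x)) (Submodule.subset_span ⟨_, hr i, rfl⟩)

theorem Generates.eq_zero_of_mul_right {A : Set R}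
    (h : Generates f.op (MulOpposite.unop ⁻¹' A)) {x : S} (hx : ∀ a ∈ A, x * f a = 0) : x = 0 :=
  MulOpposite.op_injective <| h.eq_zero_of_mul (x := MulOpposite.op x) fun a ha =>
    MulOpposite.unop_injective <| by simpa using hx _ ha

end Generation

/-! ### Fractions and annihilators -/

section Fractional

variable {R : Type u} {S : Type v} [Ring R] [Ring S]

/-- The left half of the element-wise condition: for every `s ∈ S`, the left denominators `r` of `s`
(those with `f(r) s ∈ f(R)`) generate `S` as a left ideal, and so do the left annihilators of every
element of the kernel of `f`. The right half is `IsLeftFractional f.op`. -/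
structure IsLeftFractional (f : R →+* S) : Prop where
  denominators : ∀ s : S, Generates f {r | f r * s ∈ Set.range f}
  annihilators : ∀ r₀ : R, f r₀ = 0 → Generates f {r | r * r₀ = 0}

namespace IsLeftFractional

variable {f : R →+* S} (hf : IsLeftFractional f)
include hf

theorem common_denominators (T : Finset S) :
    Generates f {r | ∀ s ∈ T, f r * s ∈ Set.range f} := by
  classical
  induction T using Finset.induction_on with
  | empty => simpa using generates_univ
  | insert s T _ ih =>
    refine ih.trans fun b hb => (hf.denominators (f b * s)).mono fun r hr s' hs' => ?_
    obtain rfl | hs' := Finset.mem_insert.1 hs'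
    · simpa [mul_assoc] using hr
    · obtain ⟨a, ha⟩ := hb s' hs'
      exact ⟨r * a, by simp [ha, mul_assoc]⟩

/-- The left ideals `I` with `S f(I) = S` are closed under `I ↦ (I : a)`. -/
theorem colon {I : Ideal R} (hI : Generates f (I : Set R)) (a : R) :
    Generates f {r | r * a ∈ I} := by
  classical
  -- Clearing denominators in an element of `S f(I)` gives an element of `f(I)`.
  have key : ∀ x ∈ Submodule.span S (f '' (I : Set R)), ∃ T : Finset S,
      ∀ b, (∀ s ∈ T, f b * s ∈ Set.range f) → ∃ c ∈ I, f b * x = f c := by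
    intro x hx
    induction hx using Submodule.closure_induction with
    | zero => exact ⟨∅, fun b _ => ⟨0, I.zero_mem, by simp⟩⟩
    | add x y _ _ hx hy =>
      obtain ⟨T, hT⟩ := hx
      obtain ⟨T', hT'⟩ := hy
      refine ⟨T ∪ T', fun b hb => ?_⟩
      obtain ⟨c, hc, h⟩ := hT b fun s hs => hb s (Finset.mem_union_left _ hs)
      obtain ⟨c', hc', h'⟩ := hT' b fun s hs => hb s (Finset.mem_union_right _ hs)
      exact ⟨c + c', I.add_mem hc hc', by rw [mul_add, h, h', map_add]⟩
    | smul_mem s x hx =>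
      obtain ⟨i, hi, rfl⟩ := hx
      refine ⟨{s}, fun b hb => ?_⟩
      obtain ⟨c, hc⟩ := hb s (Finset.mem_singleton_self s)
      exact ⟨c * i, I.mul_mem_left c hi, by rw [smul_eq_mul, ← mul_assoc, ← hc, map_mul]⟩
  obtain ⟨T, hT⟩ := key (f a) (by rw [show Submodule.span S (f '' (I : Set R)) = ⊤ from hI]; trivial)
  refine (hf.common_denominators T).trans fun b hb => ?_
  obtain ⟨c, hc, h⟩ := hT b hb
  -- `b * a` lies in `I` only up to the kernel of `f`, hence after multiplication by annihilators.
  refine (hf.annihilators (b * a - c) (by simp [h])).mono fun r hr => ?_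
  have hr : r * (b * a) = r * c := by simpa [mul_sub, sub_eq_zero] using hr
  simpa [mul_assoc, hr] using I.mul_mem_left r hc

theorem isRingEpi : IsRingEpi (f : R →ₙ+* S) := by
  intro T _ g h hgh
  have hfr : ∀ r, g (f r) = h (f r) := fun r => DFunLike.congr_fun hgh r
  ext s
  obtain ⟨n, r, t, hr, hsum⟩ := generates_iff_exists_sum.1 (hf.denominators s)
  have h1 : g 1 = h 1 := by simpa using hfr 1
  have hterm : ∀ i, g (t i * f (r i) * s) = g (t i * f (r i)) * h s := fun i => by
    obtain ⟨a, ha⟩ := hr i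
    rw [mul_assoc, map_mul, ← ha, hfr, ha, map_mul, ← hfr, ← mul_assoc, ← map_mul]
  calc g s = g (∑ i, t i * f (r i) * s) := by rw [← Finset.sum_mul, hsum, one_mul]
    _ = g 1 * h s := by rw [map_sum, Finset.sum_congr rfl fun i _ => hterm i, ← Finset.sum_mul,
        ← map_sum, hsum]
    _ = h s := by rw [h1, ← map_mul, one_mul]

end IsLeftFractional

end Fractional

/-! ### Extension along not necessarily injective maps -/

section Factor

/-- A module that satisfies Baer's criterion admits extensions along any `p` whose kernel is killed,
with no restriction on universes. -/
theorem exists_comp_eq_of_baer {R P M Q : Type*} [Ring R] [AddCommGroup P] [Module R P]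
    [AddCommGroup M] [Module R M] [AddCommGroup Q] [Module R Q] (hQ : Module.Baer R Q)
    (p : P →ₗ[R] M) (g : P →ₗ[R] Q) (h : LinearMap.ker p ≤ LinearMap.ker g) :
    ∃ c : M →ₗ[R] Q, ∀ x, c (p x) = g x := by
  obtain ⟨c, hc⟩ := hQ.extension_property ((LinearMap.ker p).liftQ p le_rfl)
    (LinearMap.ker_eq_bot.1 (Submodule.ker_liftQ_eq_bot' _ _ rfl)) ((LinearMap.ker p).liftQ g h)
  exact ⟨c, fun x => by simpa using LinearMap.congr_fun hc (Submodule.Quotient.mk x)⟩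

theorem exists_addMonoidHom_comp_eq {P M : Type*} [AddCommGroup P] [AddCommGroup M]
    (p : P →+ M) (g : P →+ AddCircle (1 : ℚ)) (h : ∀ x, p x = 0 → g x = 0) :
    ∃ c : M →+ AddCircle (1 : ℚ), ∀ x, c (p x) = g x := by
  obtain ⟨c, hc⟩ := exists_comp_eq_of_baer (Module.Baer.of_divisible (AddCircle (1 : ℚ)))
    p.toIntLinearMap g.toIntLinearMap fun x hx => h x hx
  exact ⟨c.toAddMonoidHom, hc⟩

end Factor

/-! ### The character module -/

section Character

variable {R : Type u} {S : Type v} [Ring R] [Ring S]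

/-- The character group `Hom_ℤ(S, ℚ/ℤ)` as a left `R`-module, where `S` is a right `R`-module
through `f`. -/
def CharMod (_f : R →+* S) : Type v := S →+ AddCircle (1 : ℚ)

variable (f : R →+* S)

namespace CharMod

instance : AddCommGroup (CharMod f) := inferInstanceAs (AddCommGroup (S →+ AddCircle (1 : ℚ)))

instance : FunLike (CharMod f) S (AddCircle (1 : ℚ)) :=
  inferInstanceAs (FunLike (S →+ AddCircle (1 : ℚ)) S (AddCircle (1 : ℚ)))

instance : AddMonoidHomClass (CharMod f) S (AddCircle (1 : ℚ)) :=
  inferInstanceAs (AddMonoidHomClass (S →+ AddCircle (1 : ℚ)) S (AddCircle (1 : ℚ)))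

variable {f}

@[ext] theorem ext {φ ψ : CharMod f} (h : ∀ s, φ s = ψ s) : φ = ψ := DFunLike.ext _ _ h

@[simp] theorem add_apply (φ ψ : CharMod f) (s : S) : (φ + ψ) s = φ s + ψ s := rfl

@[simp] theorem zero_apply (s : S) : (0 : CharMod f) s = 0 := rfl

instance : SMul R (CharMod f) :=
  ⟨fun r φ => AddMonoidHom.comp (φ : S →+ AddCircle (1 : ℚ)) (AddMonoidHom.mulRight (f r))⟩

@[simp] theorem smul_apply (r : R) (φ : CharMod f) (s : S) : (r • φ) s = φ (s * f r) := rfl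

instance : Module R (CharMod f) where
  one_smul φ := by ext; simp
  mul_smul a b φ := by ext; simp [mul_assoc]
  smul_zero a := by ext; simp
  smul_add a φ ψ := by ext; simp
  add_smul a b φ := by ext; simp [mul_add]
  zero_smul φ := by ext; simp

end CharMod

/-- A homomorphism `g : I → C` extends to `R` if the characters `s ↦ g(i)(s)` come from one character
`c` of `S`, that is, `c(s f(i)) = g(i)(s)`. Such a `c` exists because a relation `∑ s f(i) = 0`
implies `∑ g(i)(s) = 0`. -/
theorem IsLeftFractional.baer {f : R →+* S} (hf : IsLeftFractional f) :
    Module.Baer R (CharMod f) := by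
  classical
  intro I g
  let p : S ⊗[ℤ] I →+ S := TensorProduct.liftAddHom
    (AddMonoidHom.mk' (fun s => (AddMonoidHom.mulLeft s).comp
      ((f : R →+ S).comp I.subtype.toAddMonoidHom)) fun a b => by ext; simp [add_mul])
    fun n s i => by simp [mul_assoc, Int.cast_comm]
  have hp : ∀ s i, p (s ⊗ₜ i) = s * f i := fun _ _ => rfl
  -- The target is all characters of `S`, not just their values at `1`, so that `f b` can act.
  let G : S ⊗[ℤ] I →+ (S →+ AddCircle (1 : ℚ)) := TensorProduct.liftAddHom
    (AddMonoidHom.mk' (fun s => AddMonoidHom.mk' (fun i =>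
      AddMonoidHom.mk' (fun t => g i (t * s)) fun a b => by rw [add_mul, map_add])
        fun a b => by ext; simp) fun a b => by ext; simp [mul_add])
    fun n s i => by
      ext t
      change g i (t * (n • s)) = g (n • i) (t * s)
      rw [mul_smul_comm, map_zsmul, map_zsmul]
      rfl
  have hG : ∀ s i t, G (s ⊗ₜ i) t = g i (t * s) := fun _ _ _ => rfl
  -- If `b` clears the denominators of `x`, then `b` times `x` has the form `1 ⊗ y`.
  have key : ∀ x, ∃ T : Finset S, ∀ b, (∀ s ∈ T, f b * s ∈ Set.range f) →
      ∃ y : I, (∀ t, G x (t * f b) = g y t) ∧ f b * p x = f y := by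
    intro x
    induction x using TensorProduct.induction_on with
    | zero => exact ⟨∅, fun b _ => ⟨0, by simp, by simp⟩⟩
    | tmul s i =>
      refine ⟨{s}, fun b hb => ?_⟩
      obtain ⟨a, ha⟩ := hb s (Finset.mem_singleton_self s)
      refine ⟨a • i, fun t => ?_, ?_⟩
      · rw [hG, map_smul, CharMod.smul_apply, ha, mul_assoc]
      · rw [hp, ← mul_assoc, ← ha, ← map_mul]; rfl
    | add x y hx hy =>
      obtain ⟨T, hT⟩ := hx
      obtain ⟨T', hT'⟩ := hy
      refine ⟨T ∪ T', fun b hb => ?_⟩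
      obtain ⟨c, h, hc⟩ := hT b fun s hs => hb s (Finset.mem_union_left _ hs)
      obtain ⟨c', h', hc'⟩ := hT' b fun s hs => hb s (Finset.mem_union_right _ hs)
      exact ⟨c + c', fun t => by simp [h, h'], by simp [mul_add, hc, hc']⟩
  have hker : ∀ x, p x = 0 → G x 1 = 0 := by
    intro x hx
    obtain ⟨T, hT⟩ := key x
    have : G x = 0 := (hf.common_denominators T).addMonoidHom_eq_zero fun b hb t => by
      obtain ⟨y, hy, hy'⟩ := hT b hb
      -- `y` is in the kernel of `f`, so it is killed by a generating set, and so is `g y`.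
      have hgy : (g y : S →+ AddCircle (1 : ℚ)) = 0 :=
        (hf.annihilators y (by rw [← hy', hx, mul_zero])).addMonoidHom_eq_zero fun r hr t => by
          have hry : r • y = 0 := Subtype.ext hr
          change g y (t * f r) = 0
          rw [← CharMod.smul_apply, ← map_smul, hry, map_zero, CharMod.zero_apply]
      rw [hy]
      exact DFunLike.congr_fun hgy t
    rw [this, AddMonoidHom.zero_apply]
  obtain ⟨c, hc⟩ := exists_addMonoidHom_comp_eq p ((AddMonoidHom.eval 1).comp G) hker
  refine ⟨LinearMap.toSpanSingleton R (CharMod f) c, fun x hx => ?_⟩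
  ext s
  have := hc (s ⊗ₜ ⟨x, hx⟩)
  simp only [hp, AddMonoidHom.comp_apply, AddMonoidHom.eval_apply_apply, hG, one_mul] at this
  exact this

/-- If the annihilator of `m` does not generate `S`, then a homomorphism to the injective module of
characters detects `m`: take a character `χ` of `S` that kills `S f(ann m)` but not `1`, and extend
`r m ↦ r χ`. -/
theorem exists_linearMap_apply_one_ne_zero {f : R →+* S} (hf : Module.Baer R (CharMod f))
    {M : Type*} [AddCommGroup M] [Module R M] (m : M) (hm : ¬ Generates f {r | r • m = 0}) :
    ∃ Φ : M →ₗ[R] CharMod f, Φ m 1 ≠ 0 := by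
  set L := Ideal.span (f '' {r | r • m = 0}) with hL
  have h1 : (L.mkQ 1 : S ⧸ L) ≠ 0 := fun h =>
    hm ((Ideal.eq_top_iff_one _).2 ((Submodule.Quotient.mk_eq_zero L).1 h))
  obtain ⟨c, hc⟩ := CharacterModule.exists_character_apply_ne_zero_of_ne_zero h1
  let χ : CharMod f := AddMonoidHom.comp (c : (S ⧸ L) →+ AddCircle (1 : ℚ)) L.mkQ.toAddMonoidHom
  have hχ : ∀ s, χ s = c (L.mkQ s) := fun _ => rfl
  obtain ⟨Φ, hΦ⟩ := exists_comp_eq_of_baer hf (LinearMap.toSpanSingleton R M m)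
    (LinearMap.toSpanSingleton R (CharMod f) χ) fun r hr => by
      have hr : r • m = 0 := by simpa using hr
      rw [LinearMap.mem_ker, LinearMap.toSpanSingleton_apply]
      ext s
      have : L.mkQ (s * f r) = 0 := (Submodule.Quotient.mk_eq_zero L).2
        (L.mul_mem_left s (Ideal.subset_span ⟨r, hr, rfl⟩))
      rw [CharMod.smul_apply, hχ, this, map_zero, CharMod.zero_apply]
  refine ⟨Φ, ?_⟩
  have := hΦ 1
  simp only [LinearMap.toSpanSingleton_apply, one_smul] at this
  rwa [this, hχ]

end Character

/-! ### Flat epimorphisms have fractions -/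

section Epi

variable {R : Type u} {S : Type v} [Ring R] [Ring S]

/-- Restriction of scalars along an epimorphism is full: the action of `S` on `X × Y` and its
conjugate by the automorphism `(x, y) ↦ (x, y + φ x)` agree on `R`. -/
theorem IsRingEpi.map_smul {f : R →ₙ+* S} (hf : IsRingEpi f) {X Y : Type v} [AddCommGroup X]
    [Module S X] [AddCommGroup Y] [Module S Y] (φ : X →+ Y)
    (hφ : ∀ (r : R) x, φ (f r • x) = f r • φ x) (s : S) (x : X) : φ (s • x) = s • φ x := by
  let g : S →+* AddMonoid.End (X × Y) := Module.toAddMonoidEnd S (X × Y)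
  let N : AddMonoid.End (X × Y) := (AddMonoidHom.inr X Y).comp (φ.comp (AddMonoidHom.fst X Y))
  have hN : N * N = 0 := AddMonoidHom.ext fun z => Prod.ext rfl (map_zero φ)
  have hN' : (1 - N) * (1 + N) = 1 := by
    rw [sub_mul, mul_add, mul_add, hN]; simp
  let h : S →ₙ+* AddMonoid.End (X × Y) :=
    { toFun := fun s => (1 + N) * g s * (1 - N)
      map_mul' := fun a b => by
        have : (1 + N) * g a * (1 - N) * ((1 + N) * g b * (1 - N)) =
            (1 + N) * g a * ((1 - N) * (1 + N)) * g b * (1 - N) := by simp only [mul_assoc]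
        rw [this, hN', mul_one, map_mul, mul_assoc (1 + N) (g a)]
      map_zero' := by simp
      map_add' := fun a b => by rw [map_add, mul_add, add_mul] }
  have hh : ∀ s z, h s z = (s • z.1, s • (z.2 - φ z.1) + φ (s • z.1)) := fun s z => by
    change s • (z - (0, φ z.1)) + (0, φ (s • (z - (0, φ z.1))).1) = _
    ext <;> simp
  have hgh : (g : S →ₙ+* AddMonoid.End (X × Y)) = h := hf _ _ _ (by
    ext r : 1
    refine AddMonoidHom.ext fun z => ?_
    change f r • z = h (f r) z
    rw [hh, hφ, ← smul_add, sub_add_cancel]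
    rfl)
  have : s • ((x, 0) : X × Y) = h s (x, 0) :=
    congrArg (fun k : S →ₙ+* AddMonoid.End (X × Y) => k s (x, 0)) hgh
  rw [hh] at this
  have := congrArg Prod.snd this
  simp only [Prod.smul_mk, smul_zero, zero_sub, smul_neg] at this
  exact (neg_add_eq_zero.1 this.symm).symm

/-- An epimorphism preserves the identity: `e = f(1)` is a central idempotent, since left
multiplication by `e` is `R`-linear, and then the identity of `S` and the projection `s ↦ e s` agree
on the image of `f`. -/
theorem IsRingEpi.map_one {f : R →ₙ+* S} (hf : IsRingEpi f) : f 1 = 1 := by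
  have h1 : ∀ r, f 1 * f r = f r := fun r => by rw [← map_mul, one_mul]
  have h2 : ∀ r, f r * f 1 = f r := fun r => by rw [← map_mul, mul_one]
  have hc : ∀ s : S, f 1 * s = s * f 1 := fun s => by
    simpa using hf.map_smul (AddMonoidHom.mulLeft (f 1)) (fun r x => by
      simp [← mul_assoc, h1, h2]) s (1 : S)
  let k : S →ₙ+* S :=
    { toFun := fun s => f 1 * s
      map_mul' := fun a b => by
        rw [mul_assoc, ← mul_assoc a, ← hc a]
        simp only [← mul_assoc, h1]
      map_zero' := mul_zero _
      map_add' := mul_add _ }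
  have : NonUnitalRingHom.id S = k := hf _ _ _ (by
    ext r
    exact (h1 r).symm)
  exact (mul_one (f 1)).symm.trans (DFunLike.congr_fun this (1 : S)).symm

theorem IsRingEpi.op {f : R →ₙ+* S} (hf : IsRingEpi f) : IsRingEpi (NonUnitalRingHom.op f) := by
  intro T _ g h hgh
  have := hf Tᵐᵒᵖ (NonUnitalRingHom.op.symm ((RingEquiv.opOp T : T →ₙ+* Tᵐᵒᵖᵐᵒᵖ).comp g))
    (NonUnitalRingHom.op.symm ((RingEquiv.opOp T : T →ₙ+* Tᵐᵒᵖᵐᵒᵖ).comp h)) (by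
      ext r
      exact congrArg MulOpposite.op (DFunLike.congr_fun hgh (MulOpposite.op r)))
  ext s
  exact MulOpposite.op_injective (DFunLike.congr_fun this s.unop)

theorem IsRingEpi.isLeftFractional {f : R →+* S} (hf : IsRingEpi (f : R →ₙ+* S))
    (hB : Module.Baer R (CharMod f)) : IsLeftFractional f where
  denominators s := by
    by_contra hs
    let _ : Module R S := Module.compHom S f
    -- `fl` is `f` as a homomorphism of left `R`-modules, and `N` its image `f(R)`.
    let fl : R →ₗ[R] S := { toFun := f, map_add' := map_add f, map_smul' := map_mul f }
    let N := LinearMap.range fl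
    obtain ⟨Φ, hΦ⟩ := exists_linearMap_apply_one_ne_zero hB (N.mkQ s) fun h =>
      hs (h.mono fun r hr => by
        have : N.mkQ (r • s) = 0 := by rw [_root_.map_smul]; exact hr
        exact (Submodule.Quotient.mk_eq_zero N).1 this)
    refine hΦ ?_
    have h1 : Φ (N.mkQ 1) = 0 := by
      have : N.mkQ 1 = 0 := (Submodule.Quotient.mk_eq_zero N).2 ⟨1, _root_.map_one f⟩
      rw [this, map_zero]
    have := hf.map_smul (X := S) (Y := CharMod (RingHom.id S))
      (Φ.comp N.mkQ).toAddMonoidHom (fun r x => (Φ.comp N.mkQ).map_smul r x) s (1 : S)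
    have := DFunLike.congr_fun this (1 : S)
    rw [smul_eq_mul, mul_one] at this
    refine this.trans ?_
    change Φ (N.mkQ 1) (1 * s) = 0
    rw [h1]; rfl
  annihilators r₀ hr₀ := by
    by_contra hs
    obtain ⟨Φ, hΦ⟩ := exists_linearMap_apply_one_ne_zero hB r₀ hs
    refine hΦ ?_
    rw [← mul_one r₀, ← smul_eq_mul, _root_.map_smul, CharMod.smul_apply, hr₀, mul_zero, map_zero]

end Epi

/-! ### Flatness and injectivity of the character module -/

section Lambek

variable {R : Type u} {S : Type v} [Ring R] [Ring S] {f : R →+* S}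

/-- The character of `S ⊗_R M` corresponding to a homomorphism from `M` to the character
module. -/
def tensorLeftLift {M : Type u} [AddCommGroup M] [Module R M] (h : M →ₗ[R] CharMod f) :
    TensorLeft (f : R →ₙ+* S) M →+ AddCircle (1 : ℚ) :=
  QuotientAddGroup.lift _ (TensorProduct.liftAddHom
    (AddMonoidHom.mk' (fun s => AddMonoidHom.mk' (fun m => h m s) fun a b => by simp)
      fun a b => by ext; simp) fun n s m => by
        change h m (n • s) = h (n • m) s
        rw [map_zsmul, map_zsmul]; rfl) (by
    rw [balancedLeft, AddSubgroup.closure_le]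
    rintro _ ⟨m, r, s, rfl⟩
    rw [SetLike.mem_coe, AddMonoidHom.mem_ker, map_sub, sub_eq_zero]
    change h m (s * f r) = h (r • m) s
    rw [map_smul, CharMod.smul_apply])

/-- The homomorphism from `M` to the character module corresponding to a character of
`S ⊗_R M`. -/
def tensorLeftCurry {M : Type u} [AddCommGroup M] [Module R M]
    (ψ : TensorLeft (f : R →ₙ+* S) M →+ AddCircle (1 : ℚ)) : M →ₗ[R] CharMod f where
  toFun m := AddMonoidHom.mk' (fun s => ψ (QuotientAddGroup.mk (s ⊗ₜ[ℤ] m))) fun a b => by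
    rw [TensorProduct.add_tmul, QuotientAddGroup.mk_add, map_add]
  map_add' m m' := by
    ext s
    change ψ (QuotientAddGroup.mk (s ⊗ₜ[ℤ] (m + m'))) = _
    rw [TensorProduct.tmul_add, QuotientAddGroup.mk_add, map_add]
    rfl
  map_smul' r m := by
    ext s
    change ψ (QuotientAddGroup.mk (s ⊗ₜ[ℤ] (r • m))) =
      ψ (QuotientAddGroup.mk ((s * f r) ⊗ₜ[ℤ] m))
    refine congrArg ψ ((QuotientAddGroup.eq_iff_sub_mem.2 ?_).symm)
    exact AddSubgroup.subset_closure ⟨m, r, s, rfl⟩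

/-- Lambek's criterion: `S` is flat as a right `R`-module if and only if its character module is
injective, in the form of Baer's criterion. -/
theorem isRightFlat_iff_baer :
    IsRightFlat (f : R →ₙ+* S) ↔ Module.Baer R (CharMod f) := by
  constructor
  · intro hf I g
    obtain ⟨c, hc⟩ := exists_addMonoidHom_comp_eq (tensorLeftMap (f : R →ₙ+* S) I.subtype)
      (tensorLeftLift g) fun x hx => by
        have : x = 0 := hf I R I.subtype I.subtype_injective (hx.trans (map_zero _).symm)
        rw [this, map_zero]
    refine ⟨tensorLeftCurry c, fun x hx => ?_⟩
    ext s
    exact hc (QuotientAddGroup.mk (s ⊗ₜ[ℤ] ⟨x, hx⟩))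
  · intro hB M N _ _ _ _ φ hφ
    rw [injective_iff_map_eq_zero]
    intro x hx
    by_contra hx0
    obtain ⟨ψ, hψ⟩ := CharacterModule.exists_character_apply_ne_zero_of_ne_zero hx0
    obtain ⟨h, hh⟩ := exists_comp_eq_of_baer hB φ
      (tensorLeftCurry (f := f) (ψ : TensorLeft (f : R →ₙ+* S) M →+ AddCircle (1 : ℚ)))
      (by rw [LinearMap.ker_eq_bot.2 hφ]; exact bot_le)
    have key : ∀ y : S ⊗[ℤ] M,
        tensorLeftLift h (tensorLeftMap (f : R →ₙ+* S) φ (QuotientAddGroup.mk y)) =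
          ψ (QuotientAddGroup.mk y) := by
      intro y
      induction y using TensorProduct.induction_on with
      | zero => simp
      | tmul s m => exact DFunLike.congr_fun (hh m) s
      | add y z hy hz => rw [QuotientAddGroup.mk_add, map_add, map_add, map_add, hy, hz]
    obtain ⟨y, rfl⟩ := QuotientAddGroup.mk_surjective x
    exact hψ (by rw [← key y, hx, map_zero])

/-- The character of `M ⊗_R S` corresponding to a homomorphism from `M` to the character
module. -/
def tensorRightLift {M : Type u} [AddCommGroup M] [Module Rᵐᵒᵖ M] (h : M →ₗ[Rᵐᵒᵖ] CharMod f.op) :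
    TensorRight (f : R →ₙ+* S) M →+ AddCircle (1 : ℚ) :=
  QuotientAddGroup.lift _ (TensorProduct.liftAddHom
    (AddMonoidHom.mk' (fun m => AddMonoidHom.mk' (fun s => h m (MulOpposite.op s))
      fun a b => by simp) fun a b => by ext; simp) fun n m s => by
        change h (n • m) (MulOpposite.op s) = h m (n • MulOpposite.op s)
        rw [map_zsmul, map_zsmul]; rfl) (by
    rw [balancedRight, AddSubgroup.closure_le]
    rintro _ ⟨m, r, s, rfl⟩
    rw [SetLike.mem_coe, AddMonoidHom.mem_ker, map_sub, sub_eq_zero]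
    change h (MulOpposite.op r • m) (MulOpposite.op s) = h m (MulOpposite.op (f r * s))
    rw [map_smul, CharMod.smul_apply]
    rfl)

/-- The homomorphism from `M` to the character module corresponding to a character of
`M ⊗_R S`. -/
def tensorRightCurry {M : Type u} [AddCommGroup M] [Module Rᵐᵒᵖ M]
    (ψ : TensorRight (f : R →ₙ+* S) M →+ AddCircle (1 : ℚ)) : M →ₗ[Rᵐᵒᵖ] CharMod f.op where
  toFun m := AddMonoidHom.mk' (fun s => ψ (QuotientAddGroup.mk (m ⊗ₜ[ℤ] s.unop))) fun a b => by
    rw [MulOpposite.unop_add, TensorProduct.tmul_add, QuotientAddGroup.mk_add, map_add]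
  map_add' m m' := by
    ext s
    change ψ (QuotientAddGroup.mk ((m + m') ⊗ₜ[ℤ] s.unop)) = _
    rw [TensorProduct.add_tmul, QuotientAddGroup.mk_add, map_add]
    rfl
  map_smul' r m := by
    ext s
    change ψ (QuotientAddGroup.mk ((r • m) ⊗ₜ[ℤ] s.unop)) =
      ψ (QuotientAddGroup.mk (m ⊗ₜ[ℤ] (f r.unop * s.unop)))
    refine congrArg ψ (QuotientAddGroup.eq_iff_sub_mem.2 ?_)
    exact AddSubgroup.subset_closure ⟨m, r.unop, s.unop, rfl⟩

/-- Lambek's criterion for the left module structure. -/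
theorem isLeftFlat_iff_baer :
    IsLeftFlat (f : R →ₙ+* S) ↔ Module.Baer Rᵐᵒᵖ (CharMod f.op) := by
  constructor
  · intro hf I g
    obtain ⟨c, hc⟩ := exists_addMonoidHom_comp_eq (tensorRightMap (f : R →ₙ+* S) I.subtype)
      (tensorRightLift g) fun x hx => by
        have : x = 0 := hf I Rᵐᵒᵖ I.subtype I.subtype_injective (hx.trans (map_zero _).symm)
        rw [this, map_zero]
    refine ⟨tensorRightCurry c, fun x hx => ?_⟩
    ext s
    exact hc (QuotientAddGroup.mk ((⟨x, hx⟩ : I) ⊗ₜ[ℤ] s.unop))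
  · intro hB M N _ _ _ _ φ hφ
    rw [injective_iff_map_eq_zero]
    intro x hx
    by_contra hx0
    obtain ⟨ψ, hψ⟩ := CharacterModule.exists_character_apply_ne_zero_of_ne_zero hx0
    obtain ⟨h, hh⟩ := exists_comp_eq_of_baer hB φ
      (tensorRightCurry (f := f) (ψ : TensorRight (f : R →ₙ+* S) M →+ AddCircle (1 : ℚ)))
      (by rw [LinearMap.ker_eq_bot.2 hφ]; exact bot_le)
    have key : ∀ y : M ⊗[ℤ] S,
        tensorRightLift h (tensorRightMap (f : R →ₙ+* S) φ (QuotientAddGroup.mk y)) =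
          ψ (QuotientAddGroup.mk y) := by
      intro y
      induction y using TensorProduct.induction_on with
      | zero => simp
      | tmul m s => exact DFunLike.congr_fun (hh m) (MulOpposite.op s)
      | add y z hy hz => rw [QuotientAddGroup.mk_add, map_add, map_add, map_add, hy, hz]
    obtain ⟨y, rfl⟩ := QuotientAddGroup.mk_surjective x
    exact hψ (by rw [← key y, hx, map_zero])

theorem epi_and_flat_iff_isLeftFractional :
    IsRingEpi (f : R →ₙ+* S) ∧ IsLeftFlat (f : R →ₙ+* S) ∧ IsRightFlat (f : R →ₙ+* S) ↔
      IsLeftFractional f ∧ IsLeftFractional f.op := by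
  rw [isLeftFlat_iff_baer, isRightFlat_iff_baer]
  exact ⟨fun ⟨he, hl, hr⟩ => ⟨he.isLeftFractional hr,
      IsRingEpi.isLeftFractional (f := f.op) he.op hl⟩,
    fun ⟨hl, hr⟩ => ⟨hl.isRingEpi, hr.baer, hl.baer⟩⟩

end Lambek

/-! ### The Gabriel filters of a ring of fractions -/

section Families

variable {R : Type u} {S : Type v} [Ring R] [Ring S] {f : R →+* S}

theorem mem_leftFamily {I : Submodule R R} :
    I ∈ leftFamily (f : R →ₙ+* S) ↔ Generates f (I : Set R) := Iff.rfl

theorem mem_rightFamily {J : Submodule Rᵐᵒᵖ R} :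
    J ∈ rightFamily (f : R →ₙ+* S) ↔ Generates f.op (MulOpposite.unop ⁻¹' (J : Set R)) :=
  span_op_eq_top_iff

/-- The Gabriel filter of the left ideals `I` with `S f(I) = S`. -/
def IsLeftFractional.leftFilter (hf : IsLeftFractional f) : LeftGabrielFilter R where
  sets := leftFamily (f : R →ₙ+* S)
  top_mem := generates_univ
  mem_of_le h hle := Generates.mono (f := f) h hle
  inf_mem {I _} h h' := Generates.trans (f := f) (B := I) h fun b hb =>
    (hf.colon h' b).mono fun r hr => ⟨I.smul_mem r hb, hr⟩
  colon_mem h a := hf.colon h a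
  mem_of_colon h h' := Generates.trans (f := f) h h'

theorem IsLeftFractional.rightColon_mem (hf : IsLeftFractional f.op) {J : Submodule Rᵐᵒᵖ R}
    (hJ : J ∈ rightFamily (f : R →ₙ+* S)) (a : R) :
    rightColon J a ∈ rightFamily (f : R →ₙ+* S) := by
  let I : Ideal Rᵐᵒᵖ :=
    { carrier := MulOpposite.unop ⁻¹' (J : Set R)
      add_mem' := fun hx hy => J.add_mem hx hy
      zero_mem' := J.zero_mem
      smul_mem' := fun c _ hx => J.smul_mem c hx }
  exact mem_rightFamily.2 (hf.colon (I := I) (mem_rightFamily.1 hJ) (MulOpposite.op a))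

/-- The Gabriel filter of the right ideals `J` with `f(J) S = S`. -/
def IsLeftFractional.rightFilter (hf : IsLeftFractional f.op) : RightGabrielFilter R where
  sets := rightFamily (f : R →ₙ+* S)
  top_mem := by
    rw [mem_rightFamily]
    exact generates_univ
  mem_of_le {J J'} h hle := by
    rw [mem_rightFamily] at h ⊢
    exact h.mono fun r hr => hle (Set.mem_preimage.1 hr)
  inf_mem {J J'} h h' := by
    rw [mem_rightFamily] at h ⊢
    refine h.trans fun b hb => ?_
    exact ((mem_rightFamily (f := f)).1 (rightColon_mem (f := f) hf h' b.unop)).mono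
      fun r hr => ⟨J.smul_mem r hb, hr⟩
  colon_mem h a := rightColon_mem (f := f) hf h a
  mem_of_colon {J J'} h h' := mem_rightFamily.2 <|
    Generates.trans (A := MulOpposite.unop ⁻¹' (J : Set R))
      (B := MulOpposite.unop ⁻¹' (J' : Set R)) (mem_rightFamily.1 h) fun b hb =>
        (mem_rightFamily.1 (h' b.unop hb)).mono fun _ hr => hr

end Families

/-! ### Compatible pairs as elements of `S` -/

section Representation

variable {R : Type u} {S : Type v} [Ring R] [Ring S] {f : R →+* S}
  {F : LeftGabrielFilter R} {G : RightGabrielFilter R}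

theorem eq_zero_of_left_mul (hF : F.sets = leftFamily (f : R →ₙ+* S)) {I : Submodule R R}
    (hI : I ∈ F.sets) {x : S} (h : ∀ i ∈ I, f i * x = 0) : x = 0 :=
  Generates.eq_zero_of_mul (f := f) (A := (I : Set R)) (mem_leftFamily.1 (hF ▸ hI)) h

theorem eq_zero_of_right_mul (hG : G.sets = rightFamily (f : R →ₙ+* S)) {J : Submodule Rᵐᵒᵖ R}
    (hJ : J ∈ G.sets) {x : S} (h : ∀ j ∈ J, x * f j = 0) : x = 0 :=
  Generates.eq_zero_of_mul_right (f := f) (A := (J : Set R)) (mem_rightFamily.1 (hG ▸ hJ)) h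

/-- The map `Rbar → S` induced by `f`; torsion elements are in the kernel of `f`. -/
def rbarMap (hF : F.sets = leftFamily (f : R →ₙ+* S)) : Rbar F G →+* S :=
  Ideal.Quotient.lift (torsion F G) f fun r hr => by
    obtain ⟨⟨I, hI, h⟩, -⟩ := (mem_torsion F G).1 hr
    exact eq_zero_of_left_mul hF hI fun i hi => by rw [← map_mul, h i hi, map_zero]

@[simp] theorem rbarMap_proj (hF : F.sets = leftFamily (f : R →ₙ+* S)) (r : R) :
    rbarMap hF (proj F G r) = f r := rfl

/-- The kernel of `f` is contained in the torsion ideal. -/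
theorem rbarMap_injective (hl : IsLeftFractional f) (hr : IsLeftFractional f.op)
    (hF : F.sets = leftFamily (f : R →ₙ+* S)) (hG : G.sets = rightFamily (f : R →ₙ+* S)) :
    Function.Injective (rbarMap (G := G) hF) := by
  rw [injective_iff_map_eq_zero]
  intro x hx
  obtain ⟨r, rfl⟩ := proj_surj x
  rw [rbarMap_proj] at hx
  refine proj_eq_zero.2 ((mem_torsion F G).2
    ⟨⟨leftColon ⊥ r, ?_, fun i hi => hi⟩, ⟨rightColon ⊥ r, ?_, fun j hj => hj⟩⟩)
  · rw [hF]
    exact hl.annihilators r hx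
  · rw [hG, mem_rightFamily]
    refine (hr.annihilators (MulOpposite.op r) (congrArg MulOpposite.op hx)).mono fun j hj => ?_
    exact congrArg MulOpposite.unop hj

/-- The compatible pair `p` consists of right and left multiplication by the element `s` of `S`. -/
def Represents (hF : F.sets = leftFamily (f : R →ₙ+* S)) (p : CompatiblePair F G) (s : S) : Prop :=
  (∀ i : p.I, rbarMap hF (p.α i) = f i * s) ∧ (∀ j : p.J, rbarMap hF (p.β j) = s * f j)

namespace Represents

variable {hF : F.sets = leftFamily (f : R →ₙ+* S)} {p q : CompatiblePair F G} {s t : S}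

theorem ofElem (a : R) : Represents hF (CompatiblePair.ofElem F G a) (f a) :=
  ⟨fun i => by simp, fun j => by simp⟩

theorem add (hp : Represents hF p s) (hq : Represents hF q t) :
    Represents hF (CompatiblePair.add p q) (s + t) :=
  ⟨fun i => by
    rw [CompatiblePair.add_α, map_add, hp.1, hq.1, mul_add],
  fun j => by
    rw [CompatiblePair.add_β, map_add, hp.2, hq.2, add_mul]⟩

theorem mul (hp : Represents hF p s) (hq : Represents hF q t) :
    Represents hF (CompatiblePair.mul p q) (s * t) := by
  constructor
  · rintro ⟨i, hi⟩
    obtain ⟨hi', k, hk⟩ := id hi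
    rw [CompatiblePair.mul_α p q hi hi' k hk, hq.1, ← rbarMap_proj (G := G) hF, hk, hp.1, mul_assoc]
  · rintro ⟨j, hj⟩
    obtain ⟨hj', k, hk⟩ := id hj
    rw [CompatiblePair.mul_β p q hj hj' k hk, hp.2, ← rbarMap_proj (G := G) hF, hk, hq.2, mul_assoc]

theorem eq_of_equivalent (hp : Represents hF p s) (hq : Represents hF q t)
    (h : p.Equivalent q) : s = t := by
  obtain ⟨⟨I, hI, hIp, hIq, hα⟩, -⟩ := h
  refine sub_eq_zero.1 (eq_zero_of_left_mul hF hI fun i hi => ?_)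
  rw [mul_sub, sub_eq_zero]
  exact (hp.1 ⟨i, hIp hi⟩).symm.trans ((congrArg _ (hα i hi)).trans (hq.1 ⟨i, hIq hi⟩))

theorem equivalent (hinj : Function.Injective (rbarMap (G := G) hF)) (hp : Represents hF p s)
    (hq : Represents hF q s) : p.Equivalent q :=
  CompatiblePair.equivalent_iff.2 ⟨fun i h h' => hinj ((hp.1 ⟨i, h⟩).trans (hq.1 ⟨i, h'⟩).symm),
    fun j h h' => hinj ((hp.2 ⟨j, h⟩).trans (hq.2 ⟨j, h'⟩).symm)⟩

/-- Every compatible pair is given by an element of `S`: if `∑ tᵢ f(rᵢ) = 1` with `rᵢ` in the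
domain of `α`, this element has to be `∑ tᵢ α(rᵢ)`. -/
theorem exists_elem (hG : G.sets = rightFamily (f : R →ₙ+* S)) (p : CompatiblePair F G) :
    ∃ s, Represents hF p s := by
  obtain ⟨n, r, t, hr, hsum⟩ := generates_iff_exists_sum.1
    (show Generates f (p.I : Set R) from mem_leftFamily.1 (hF ▸ p.I_mem))
  have hcompat : ∀ (i : p.I) (j : p.J),
      rbarMap hF (p.α i) * f j = f i * rbarMap hF (p.β j) := fun i j => by
    simpa using congrArg (rbarMap hF) (p.compat i j)
  -- By compatibility, `(∑ tᵢ α(rᵢ)) f(j) = (∑ tᵢ f(rᵢ)) β(j) = β(j)`.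
  have hβ : ∀ j : p.J, rbarMap hF (p.β j) = (∑ i, t i * rbarMap hF (p.α ⟨r i, hr i⟩)) * f j := by
    intro j
    rw [Finset.sum_mul]
    simp_rw [mul_assoc, hcompat, ← mul_assoc]
    rw [← Finset.sum_mul, hsum, one_mul]
  refine ⟨_, fun i => ?_, hβ⟩
  refine sub_eq_zero.1 (eq_zero_of_right_mul hG p.J_mem fun j hj => ?_)
  rw [sub_mul, sub_eq_zero, mul_assoc, ← hβ ⟨j, hj⟩]
  exact hcompat i ⟨j, hj⟩

/-- Every element of `S` gives rise to a compatible pair. -/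
theorem exists_pair (hl : IsLeftFractional f) (hr : IsLeftFractional f.op)
    (hF : F.sets = leftFamily (f : R →ₙ+* S)) (hG : G.sets = rightFamily (f : R →ₙ+* S)) (s : S) :
    ∃ p : CompatiblePair F G, Represents hF p s := by
  have hinj := rbarMap_injective hl hr hF hG
  let I : Submodule R R :=
    { carrier := {i | f i * s ∈ Set.range f}
      add_mem' := by
        rintro a b ⟨x, hx⟩ ⟨y, hy⟩
        exact ⟨x + y, by rw [map_add, map_add, add_mul, hx, hy]⟩
      zero_mem' := ⟨0, by simp⟩
      smul_mem' := by
        rintro c a ⟨x, hx⟩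
        exact ⟨c * x, by rw [map_mul, hx, smul_eq_mul, map_mul, mul_assoc]⟩ }
  let J : Submodule Rᵐᵒᵖ R :=
    { carrier := {j | s * f j ∈ Set.range f}
      add_mem' := by
        rintro a b ⟨x, hx⟩ ⟨y, hy⟩
        exact ⟨x + y, by rw [map_add, map_add, mul_add, hx, hy]⟩
      zero_mem' := ⟨0, by simp⟩
      smul_mem' := by
        rintro c a ⟨x, hx⟩
        exact ⟨x * c.unop, by
          rw [map_mul, hx, MulOpposite.smul_eq_mul_unop, map_mul, mul_assoc]⟩ }
  have hI : I ∈ F.sets := by rw [hF]; exact hl.denominators s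
  have hJ : J ∈ G.sets := by
    rw [hG, mem_rightFamily]
    refine (hr.denominators (MulOpposite.op s)).mono fun j hj => ?_
    obtain ⟨a, ha⟩ := hj
    exact ⟨a.unop, congrArg MulOpposite.unop ha⟩
  choose a ha using fun i : I => i.2
  choose b hb using fun j : J => j.2
  refine ⟨
    { I := I
      I_mem := hI
      J := J
      J_mem := hJ
      α := AddMonoidHom.mk' (fun i => proj F G (a i)) fun x y => hinj ?_
      α_smul := fun r i => hinj ?_
      β := AddMonoidHom.mk' (fun j => proj F G (b j)) fun x y => hinj ?_
      β_smul := fun r j => hinj ?_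
      compat := fun i j => hinj ?_ }, fun i => ha i, fun j => hb j⟩
  · simp [ha, add_mul]
  · simp [ha, mul_assoc]
  · simp [hb, mul_add]
  · simp [hb, mul_assoc]
  · simp [ha, hb, mul_assoc]

end Represents

end Representation

/-! ### The symmetric ring of quotients and fractions -/

section Quotient

variable {R : Type u} {S : Type v} [Ring R] [Ring S] {f : R →+* S}

theorem isSymmetricQuotient_of_isLeftFractional (hl : IsLeftFractional f)
    (hr : IsLeftFractional f.op) : IsSymmetricQuotientOfFamilies (f : R →ₙ+* S) := by
  let F := hl.leftFilter
  let G := hr.rightFilter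
  have hF : F.sets = leftFamily (f : R →ₙ+* S) := rfl
  have hG : G.sets = rightFamily (f : R →ₙ+* S) := rfl
  refine ⟨F, G, hF, hG, ?_⟩
  have hinj := rbarMap_injective hl hr hF hG
  choose e he using Represents.exists_elem (hF := hF) hG
  let φ : SymmetricQuotient F G →+* S :=
    { toFun := Quotient.lift e fun p q h => (he p).eq_of_equivalent (he q) h
      map_one' := ((he _).eq_of_equivalent (Represents.ofElem 1) (.refl _)).trans (map_one f)
      map_zero' := ((he _).eq_of_equivalent (Represents.ofElem 0) (.refl _)).trans (map_zero f)
      map_add' := by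
        rintro ⟨p⟩ ⟨q⟩
        exact (he _).eq_of_equivalent ((he p).add (he q)) (.refl _)
      map_mul' := by
        rintro ⟨p⟩ ⟨q⟩
        exact (he _).eq_of_equivalent ((he p).mul (he q)) (.refl _) }
  have hφ : Function.Bijective φ := by
    constructor
    · rintro ⟨p⟩ ⟨q⟩ h
      have h : e p = e q := h
      exact Quotient.sound ((he p).equivalent hinj (h ▸ he q))
    · intro s
      obtain ⟨p, hp⟩ := Represents.exists_pair hl hr hF hG s
      exact ⟨Quotient.mk _ p, (he p).eq_of_equivalent hp (.refl _)⟩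
  refine ⟨(RingEquiv.ofBijective φ hφ).symm, fun r => ?_⟩
  rw [RingEquiv.symm_apply_eq]
  exact ((he _).eq_of_equivalent (Represents.ofElem r) (.refl _)).symm

variable {F : LeftGabrielFilter R} {G : RightGabrielFilter R}

/-- The class of a compatible pair in the symmetric ring of quotients. -/
def classOf (p : CompatiblePair F G) : SymmetricQuotient F G := Quotient.mk _ p

/-- Elements of the domain of `α` are left denominators of the class of `(α, β)`. -/
theorem canonicalMap_mul_classOf (p : CompatiblePair F G) (i : p.I) (a : R)
    (ha : proj F G a = p.α i) :
    SymmetricQuotient.canonicalMap F G i * classOf p =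
      SymmetricQuotient.canonicalMap F G a := by
  refine Quotient.sound (CompatiblePair.equivalent_iff.2 ⟨fun x hx hx' => ?_, fun j hj hj' => ?_⟩)
  · refine (CompatiblePair.mul_α _ p hx trivial (x • i) rfl).trans ?_
    rw [p.α_smul, ← ha, CompatiblePair.ofElem_α, map_mul]
  · obtain ⟨hj₁, k, hk⟩ := id hj
    rw [CompatiblePair.mul_β _ p hj hj₁ k hk, CompatiblePair.ofElem_β, CompatiblePair.ofElem_β,
      map_mul, hk, ← p.compat, ← ha, map_mul]

/-- Elements of the domain of `β` are right denominators of the class of `(α, β)`. -/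
theorem classOf_mul_canonicalMap (p : CompatiblePair F G) (j : p.J) (a : R)
    (ha : proj F G a = p.β j) :
    classOf p * SymmetricQuotient.canonicalMap F G j =
      SymmetricQuotient.canonicalMap F G a := by
  refine Quotient.sound (CompatiblePair.equivalent_iff.2 ⟨fun i hi hi' => ?_, fun x hx hx' => ?_⟩)
  · obtain ⟨hi₁, k, hk⟩ := id hi
    rw [CompatiblePair.mul_α p _ hi hi₁ k hk, CompatiblePair.ofElem_α, CompatiblePair.ofElem_α,
      map_mul, hk, p.compat, ← ha, map_mul]
  · refine (CompatiblePair.mul_β p _ hx trivial (MulOpposite.op x • j) rfl).trans ?_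
    rw [p.β_smul, ← ha, CompatiblePair.ofElem_β, map_mul]

theorem canonicalMap_eq_zero {r : R} (h : SymmetricQuotient.canonicalMap F G r = 0) :
    r ∈ torsion F G := by
  have := (CompatiblePair.equivalent_iff.1 (Quotient.exact h)).1 1 trivial trivial
  rw [← proj_eq_zero]
  simpa using this

theorem isLeftFractional_of_isSymmetricQuotient
    (h : IsSymmetricQuotientOfFamilies (f : R →ₙ+* S)) :
    IsLeftFractional f ∧ IsLeftFractional f.op := by
  obtain ⟨F, G, hF, hG, g, hg⟩ := h
  have hg : ∀ r, g (f r) = SymmetricQuotient.canonicalMap F G r := hg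
  have hker : ∀ r, f r = 0 → r ∈ torsion F G := fun r hr =>
    canonicalMap_eq_zero (by rw [← hg, hr, map_zero])
  refine ⟨⟨fun s => ?_, fun r hr => ?_⟩, ⟨fun s => ?_, fun r hr => ?_⟩⟩
  · obtain ⟨p, hp⟩ := Quotient.exists_rep (g s)
    refine Generates.mono (A := (p.I : Set R)) (mem_leftFamily.1 (hF ▸ p.I_mem)) fun i hi => ?_
    obtain ⟨a, ha⟩ := proj_surj (p.α ⟨i, hi⟩)
    refine ⟨a, g.injective ?_⟩
    rw [hg, map_mul, hg, ← hp]
    exact (canonicalMap_mul_classOf p ⟨i, hi⟩ a ha).symm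
  · obtain ⟨⟨I, hI, h⟩, -⟩ := (mem_torsion F G).1 (hker r hr)
    exact Generates.mono (A := (I : Set R)) (mem_leftFamily.1 (hF ▸ hI)) h
  · obtain ⟨p, hp⟩ := Quotient.exists_rep (g s.unop)
    refine (mem_rightFamily.1 (hG ▸ p.J_mem)).mono fun j hj => ?_
    obtain ⟨a, ha⟩ := proj_surj (p.β ⟨j.unop, hj⟩)
    refine ⟨MulOpposite.op a, MulOpposite.unop_injective (g.injective ?_)⟩
    change g (f a) = g (s.unop * f j.unop)
    rw [hg, map_mul, hg, ← hp]
    exact (classOf_mul_canonicalMap p ⟨j.unop, hj⟩ a ha).symm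
  · obtain ⟨-, J, hJ, h⟩ := (mem_torsion F G).1 (hker r.unop (congrArg MulOpposite.unop hr))
    refine (mem_rightFamily.1 (hG ▸ hJ)).mono fun j hj => ?_
    exact MulOpposite.unop_injective (h j.unop hj)

/-- The two fraction conditions in terms of finite sums. -/
theorem isLeftFractional_iff_exists_sum : IsLeftFractional f ∧ IsLeftFractional f.op ↔
    (∀ s : S,
      (∃ (n : ℕ) (r : Fin n → R) (t : Fin n → S),
        (∀ i, f (r i) * s ∈ Set.range f) ∧ ∑ i, t i * f (r i) = 1) ∧
      (∃ (m : ℕ) (r : Fin m → R) (t : Fin m → S),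
        (∀ j, s * f (r j) ∈ Set.range f) ∧ ∑ j, f (r j) * t j = 1)) ∧
    (∀ r₀ : R, f r₀ = 0 →
      (∃ (n : ℕ) (r : Fin n → R) (t : Fin n → S),
        (∀ i, r i * r₀ = 0) ∧ ∑ i, t i * f (r i) = 1) ∧
      (∃ (m : ℕ) (r : Fin m → R) (t : Fin m → S),
        (∀ j, r₀ * r j = 0) ∧ ∑ j, f (r j) * t j = 1)) := by
  have hden : ∀ s : S, {r | f.op r * MulOpposite.op s ∈ Set.range f.op} =
      MulOpposite.unop ⁻¹' {r | s * f r ∈ Set.range f} := fun s => by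
    ext r
    constructor
    · rintro ⟨a, ha⟩
      exact ⟨a.unop, congrArg MulOpposite.unop ha⟩
    · rintro ⟨a, ha⟩
      exact ⟨MulOpposite.op a, congrArg MulOpposite.op ha⟩
  have hann : ∀ r₀ : R, {r | r * MulOpposite.op r₀ = 0} =
      MulOpposite.unop ⁻¹' {r | r₀ * r = 0} := fun r₀ => by
    ext r
    exact ⟨fun h => congrArg MulOpposite.unop h, fun h => MulOpposite.unop_injective h⟩
  constructor
  · rintro ⟨hl, hr⟩
    refine ⟨fun s => ⟨generates_iff_exists_sum.1 (hl.denominators s),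
      generates_op_iff_exists_sum.1 (hden s ▸ hr.denominators (MulOpposite.op s))⟩,
      fun r₀ h₀ => ⟨generates_iff_exists_sum.1 (hl.annihilators r₀ h₀),
      generates_op_iff_exists_sum.1
        (hann r₀ ▸ hr.annihilators (MulOpposite.op r₀) (congrArg MulOpposite.op h₀))⟩⟩
  · rintro ⟨h1, h2⟩
    refine ⟨⟨fun s => generates_iff_exists_sum.2 (h1 s).1,
      fun r₀ h₀ => generates_iff_exists_sum.2 (h2 r₀ h₀).1⟩,
      ⟨fun s => ?_, fun r₀ h₀ => ?_⟩⟩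
    · have := generates_op_iff_exists_sum (f := f) (A := {r | s.unop * f r ∈ Set.range f}).2
        (h1 s.unop).2
      rwa [← hden] at this
    · have := generates_op_iff_exists_sum (f := f) (A := {r | r₀.unop * r = 0}).2
        (h2 r₀.unop (congrArg MulOpposite.unop h₀)).2
      rwa [← hann] at this

/-- A homomorphism that preserves the identity is the underlying non-unital homomorphism of a
homomorphism of rings with identity. -/
theorem exists_coe_eq {f : R →ₙ+* S} (h : f 1 = 1) : ∃ f' : R →+* S, (f' : R →ₙ+* S) = f :=
  ⟨{ f with map_one' := h }, rfl⟩

end Quotient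

end SymQuot

theorem mainTheorem1 {R : Type u} {S : Type v} [Ring R] [Ring S] (f : R →ₙ+* S) :
    List.TFAE [
      SymQuot.IsRingEpi f ∧ SymQuot.IsLeftFlat f ∧ SymQuot.IsRightFlat f,
      SymQuot.IsSymmetricQuotientOfFamilies f,
      (∀ s : S,
        (∃ (n : ℕ) (r : Fin n → R) (t : Fin n → S),
          (∀ i, f (r i) * s ∈ Set.range f) ∧ ∑ i, t i * f (r i) = 1) ∧
        (∃ (m : ℕ) (r : Fin m → R) (t : Fin m → S),
          (∀ j, s * f (r j) ∈ Set.range f) ∧ ∑ j, f (r j) * t j = 1)) ∧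
      (∀ r₀ : R, f r₀ = 0 →
        (∃ (n : ℕ) (r : Fin n → R) (t : Fin n → S),
          (∀ i, r i * r₀ = 0) ∧ ∑ i, t i * f (r i) = 1) ∧
        (∃ (m : ℕ) (r : Fin m → R) (t : Fin m → S),
          (∀ j, r₀ * r j = 0) ∧ ∑ j, f (r j) * t j = 1))] := by
  by_cases h1 : f 1 = 1
  · obtain ⟨f, rfl⟩ := SymQuot.exists_coe_eq h1
    tfae_have 1 ↔ 3 := SymQuot.epi_and_flat_iff_isLeftFractional.trans
      SymQuot.isLeftFractional_iff_exists_sum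
    tfae_have 2 ↔ 3 := Iff.trans ⟨SymQuot.isLeftFractional_of_isSymmetricQuotient,
      fun h => SymQuot.isSymmetricQuotient_of_isLeftFractional h.1 h.2⟩
      SymQuot.isLeftFractional_iff_exists_sum
    tfae_finish
  · -- Each of the conditions forces `f` to preserve the identity.
    tfae_have 1 → 2 := fun h => absurd h.1.map_one h1
    tfae_have 2 → 3 := by
      rintro ⟨F, G, -, -, g, hg⟩
      exact absurd (g.injective ((hg 1).trans ((map_one _).trans (map_one g).symm))) h1
    tfae_have 3 → 1 := by
      rintro ⟨h, -⟩
      obtain ⟨⟨n, r, t, -, hsum⟩, -⟩ := h 1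
      refine absurd ?_ h1
      calc f 1 = (∑ i, t i * f (r i)) * f 1 := by rw [hsum, one_mul]
        _ = ∑ i, t i * f (r i) := by
          rw [Finset.sum_mul]
          exact Finset.sum_congr rfl fun i _ => by rw [mul_assoc, ← map_mul, mul_one]
        _ = 1 := hsum
    tfae_finish
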